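/- Let $p\ge 1$ and let $(X_i,Y_i)$, $i\ge 1$, be independent copies of a random pair $(X,Y)\in\mathbb R^p\times\mathbb R$, where $X$ has a probability density $g$ and $\bar F(y|x)=\mathbb P(Y>y\mid X=x)$ is (a fixed version of) the conditional survival function. Let $q(\alpha|x)=\inf\{t:\bar F(t|x)\le\alpha\}$ for $\alpha\in(0,1)$, let $y_F(x)=\inf\{t:\bar F(t|x)\le 0\}\in(-\infty,\infty]$, and let $f(\cdot|x)=-\bar F'(\cdot|x)$ denote the conditional density. For a function $K$ on $\mathbb R^p$ and a nonrandom sequence $h=h_n>0$ with $h_n\to0$, put $K_h(t)=K(t/h)/h^p$, $$\hat{\bar F}_n(y|x)=\frac{\sum_{i=1}^nK_h(x-X_i)\mathbf 1\{Y_i>y\}}{\sum_{i=1}^nK_h(x-X_i)},\qquad \hat q_n(\alpha|x)=\inf\{t:\hat{\bar F}_n(t|x)\le\alpha\}.$$ For $0<\kappa<\lambda$ let $$\Delta_{\kappa,\lambda}(x,\alpha)=\sup\Big\{\Big|\frac{\bar F(q(\beta|x)|x')}{\beta}-1\Big| : x'\in B(x,h),\ \beta\in[\kappa\alpha,\lambda\alpha]\Big\},$$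 where $B(x,h)$ is the Euclidean ball of centre $x$ and radius $h$. Let $x\in\mathbb R^p$ with $g(x)>0$ and assume: (A.1) In a left neighbourhood of $y_F(x)$ the function $\bar F(\cdot|x)$ is twice differentiable with non-zero first derivative, $\bar F(y|x)\to0$ and $\bar F(y|x)\bar F''(y|x)/(\bar F'(y|x))^2\to\gamma(x)+1$ as $y\uparrow y_F(x)$, where $\gamma(x)\in\mathbb R$. (A.2) There exists $c_g>0$ such that $|g(z)-g(z')|\le c_g\,\|z-z'\|$ for all $z,z'\in\mathbb R^p$. (A.3) $K$ is a bounded probability density on $\mathbb R^p$ with support in the closed unit ball. Let $J\ge1$ and $0<\tau_J<\dots<\tau_2<\tau_1\le1$, and let $\alpha_n\in(0,1)$ with $\alpha_n\to0$. Suppose that there exist $\kappa\in(0,\tau_J)$ and $\lambda>\tau_1$ such that (where $\lambda=1$ is allowed when $\tau_1<1$) $$nh^p\alpha_n\to\infty,\qquad nh^p\alpha_n\big(h\vee\Delta_{\kappa,\lambda}(x,\alpha_n)\big)^2\to0 .$$ Then the random vector $$\Big\{f\big(q(\alpha_n|x)|x\big)\sqrt{nh^p\alpha_n^{-1}}\,\big(\hat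 q_n(\tau_j\alpha_n|x)-q(\tau_j\alpha_n|x)\big)\Big\}_{j=1,\dots,J}$$ converges in distribution to the centered Gaussian vector with covariance matrix $\frac{\|K\|_2^2}{g(x)}\Sigma(x)$, where $\|K\|_2^2=\int K^2$ and $\Sigma_{j,j'}(x)=(\tau_j\tau_{j'})^{-\gamma(x)}\,\tau_{j\wedge j'}^{-1}$ for $1\le j,j'\le J$. -/

import Mathlib

open MeasureTheory ProbabilityTheory Filter Topology Set

noncomputable section

namespace ExtremalQuantile

/-! ### Survival functions and upper quantiles -/

/-- The generalized inverse `inf {t | S t ≤ α}` of a survival function `S`. -/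
def upperQuantile (S : ℝ → ℝ) (α : ℝ) : ℝ := sInf {t : ℝ | S t ≤ α}

/-- The right endpoint `inf {t | S t ≤ 0}` in the extended reals (`⊤` if `S` never vanishes). -/
def rightEndpoint (S : ℝ → ℝ) : EReal := sInf ((fun t : ℝ => (t : EReal)) '' {t : ℝ | S t ≤ 0})

/-- The filter of real numbers `y` that increase to the right endpoint of `S` (the left
neighbourhoods of the endpoint if it is finite, and `atTop` if it is infinite). -/
def leftOfEndpoint (S : ℝ → ℝ) : Filter ℝ :=
  comap (fun t : ℝ => (t : EReal)) (𝓝[<] (rightEndpoint S))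

/-- The von Mises condition with extreme-value index `γ` for a survival function `S`. The
smoothness is only required in a left neighbourhood of the right endpoint, where the quotient in
the limit has to make sense; `S` has no atom at its right endpoint. -/
structure VonMises (S : ℝ → ℝ) (γ : ℝ) : Prop where
  twice_differentiable :
    ∀ᶠ y in leftOfEndpoint S, DifferentiableAt ℝ S y ∧ DifferentiableAt ℝ (deriv S) y
  deriv_ne_zero : ∀ᶠ y in leftOfEndpoint S, deriv S y ≠ 0
  no_atom : Tendsto S (leftOfEndpoint S) (𝓝 0)
  limit : Tendsto (fun y => S y * deriv (deriv S) y / (deriv S y) ^ 2) (leftOfEndpoint S)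
    (𝓝 (γ + 1))

/-! ### The regression model -/

/-- `ℝ^p` with its Euclidean distance. -/
abbrev Cov (p : ℕ) : Type := EuclideanSpace ℝ (Fin p)

/-- The conditional survival function `y ↦ P(Y > y | X = x)`, where the Markov kernel `Q` is
the conditional distribution of `Y` given `X`. -/
def condSurvival {p : ℕ} (Q : Kernel (Cov p) ℝ) (x : Cov p) (y : ℝ) : ℝ := (Q x).real (Ioi y)

/-- The conditional density `f(y|x)`, minus the derivative of the conditional survival function. -/
def condDensity {p : ℕ} (Q : Kernel (Cov p) ℝ) (x : Cov p) (y : ℝ) : ℝ :=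
  -deriv (condSurvival Q x) y

/-- The conditional quantile `q(α|x)`. -/
def condQuantile {p : ℕ} (Q : Kernel (Cov p) ℝ) (α : ℝ) (x : Cov p) : ℝ :=
  upperQuantile (condSurvival Q x) α

/-- `(X i, Y i)`, `i ∈ ℕ`, are independent copies of a random pair `(X, Y)` in `ℝ^p × ℝ`, where
`X` has the density `g` and `Q` is the conditional distribution of `Y` given `X`. -/
structure IsSample {p : ℕ} {Ω : Type*} [MeasurableSpace Ω] (P : Measure Ω)
    (X : ℕ → Ω → Cov p) (Y : ℕ → Ω → ℝ) (g : Cov p → ℝ) (Q : Kernel (Cov p) ℝ) : Prop where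
  measurable_X : ∀ i, Measurable (X i)
  measurable_Y : ∀ i, Measurable (Y i)
  indep : iIndepFun (fun i ω => (X i ω, Y i ω)) P
  measurable_g : Measurable g
  g_nonneg : ∀ z, 0 ≤ g z
  law : ∀ i, P.map (fun ω => (X i ω, Y i ω)) =
    (volume.withDensity (fun z => ENNReal.ofReal (g z))) ⊗ₘ Q

/-- `K` is a bounded probability density on `ℝ^p` with support in the unit ball. -/
structure IsSmoothingKernel {p : ℕ} (K : Cov p → ℝ) : Prop where
  measurable : Measurable K
  nonneg : ∀ u, 0 ≤ K u
  integrable : Integrable K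
  integral_eq_one : ∫ u, K u = 1
  bounded : ∃ M : ℝ, ∀ u, K u ≤ M
  support_subset : Function.support K ⊆ Metric.closedBall 0 1

/-- `K_h(t) = K(t/h)/h^p`. -/
def rescaled {p : ℕ} (K : Cov p → ℝ) (h : ℝ) (t : Cov p) : ℝ := K (h⁻¹ • t) / h ^ p

/-- The kernel estimator of the conditional survival function, from the first `n` pairs. -/
def kernelSurvival {p : ℕ} (K : Cov p → ℝ) (h : ℝ) (n : ℕ) (X : ℕ → Cov p) (Y : ℕ → ℝ)
    (x : Cov p) (y : ℝ) : ℝ :=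
  (∑ i ∈ Finset.range n, rescaled K h (x - X i) * (Ioi y).indicator 1 (Y i)) /
    ∑ i ∈ Finset.range n, rescaled K h (x - X i)

/-- The kernel estimator of the conditional quantile, from the first `n` pairs. -/
def kernelQuantile {p : ℕ} (K : Cov p → ℝ) (h : ℝ) (n : ℕ) (X : ℕ → Cov p) (Y : ℕ → ℝ)
    (α : ℝ) (x : Cov p) : ℝ :=
  upperQuantile (kernelSurvival K h n X Y x) α

/-- The oscillation of the conditional survival function: the supremum of
`|F(q(β|x)|x') / β - 1|` over `x'` in the ball `B(x,h)` and `β ∈ [κ α, l α]`. -/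
def oscillation {p : ℕ} (Q : Kernel (Cov p) ℝ) (h κ l : ℝ) (x : Cov p) (α : ℝ) : ℝ :=
  sSup ((fun z : Cov p × ℝ => |condSurvival Q z.1 (condQuantile Q z.2 x) / z.2 - 1|) ''
    (Metric.ball x h ×ˢ Icc (κ * α) (l * α)))

/-- The supremum that defines the oscillation is over a bounded set. -/
theorem oscillation_bddAbove {p : ℕ} (Q : Kernel (Cov p) ℝ) [IsMarkovKernel Q] {h κ l : ℝ}
    (x : Cov p) {α : ℝ} (hκ : 0 < κ) (hα : 0 < α) :
    BddAbove ((fun z : Cov p × ℝ => |condSurvival Q z.1 (condQuantile Q z.2 x) / z.2 - 1|) ''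
      (Metric.ball x h ×ˢ Icc (κ * α) (l * α))) := by
  refine ⟨1 / (κ * α) + 1, ?_⟩
  rintro _ ⟨⟨x', β⟩, ⟨-, hβ, -⟩, rfl⟩
  have hpos : 0 < κ * α := mul_pos hκ hα
  have h0 : 0 ≤ condSurvival Q x' (condQuantile Q β x) := measureReal_nonneg
  have h1 : condSurvival Q x' (condQuantile Q β x) ≤ 1 := measureReal_le_one
  have h2 : condSurvival Q x' (condQuantile Q β x) / β ≤ 1 / (κ * α) := by gcongr
  have h3 : 0 ≤ condSurvival Q x' (condQuantile Q β x) / β :=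
    div_nonneg h0 (hpos.le.trans hβ)
  exact abs_le.2 ⟨by dsimp only; linarith [one_div_pos.2 hpos], by dsimp only; linarith⟩

/-- The matrix `Σ` with entries `(τ_j τ_j')^(-γ) / τ_{min(j,j')}`. -/
def sigmaMatrix {J : ℕ} (τ : Fin J → ℝ) (γ : ℝ) : Matrix (Fin J) (Fin J) ℝ :=
  Matrix.of fun j j' => (τ j * τ j') ^ (-γ) * (τ (min j j'))⁻¹

/-- The asymptotic covariance matrix `‖K‖₂² / g(x) • Σ(x)`. -/
def asymptoticCov {p J : ℕ} (K g : Cov p → ℝ) (γ : Cov p → ℝ) (τ : Fin J → ℝ) (x : Cov p) :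
    Matrix (Fin J) (Fin J) ℝ :=
  ((∫ u, K u ^ 2) / g x) • sigmaMatrix τ (γ x)

/-- The normalized vector of estimation errors
`f(q(α|x)|x) √(n h^p α⁻¹) (q̂_n(τ_j α|x) - q(τ_j α|x))`, `j = 1, …, J`. -/
def normalizedError {p J : ℕ} (Q : Kernel (Cov p) ℝ) (K : Cov p → ℝ) (τ : Fin J → ℝ)
    (x : Cov p) (n : ℕ) (h α : ℝ) (X : ℕ → Cov p) (Y : ℕ → ℝ) : EuclideanSpace ℝ (Fin J) :=
  WithLp.toLp 2 fun j =>
    condDensity Q x (condQuantile Q α x) * √(n * h ^ p * α⁻¹) *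
      (kernelQuantile K h n X Y (τ j * α) x - condQuantile Q (τ j * α) x)

end ExtremalQuantile

end

/-! Bahadur-type argument. Write `r = √(n h^p α)`. Off the event that all weights vanish, `q̂(τα) ≤
y` holds exactly when `∑ K((x - X i)/h) (1{Y i > y} - τα) ≤ 0`, so a statement about a random
infimum becomes one about a sum of i.i.d. terms, with no random denominator left. Take `y` to be the
conditional quantile of the slightly shifted level `β = τα (1 - τ^γ z / r)` and call `Z z` the sum
divided by `r`.

Two facts drive the proof. The deterministic one is that `f(q(α)) (r/α) (q(β) - q(τα)) → z`
(`VonMises.tendsto_upperQuantile_sub`). The von Mises quotient `S S'' / S'^2` is the derivative of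
`log (-S')` with respect to `log S`, so its limit `γ + 1` forces `f(q(τα)) / f(q(α)) → τ^(γ+1)`, and
the mean value theorem gives the expansion. The stochastic one is that `Z z = Z 0 - c z + o_P(1)`
with `c = g(x) τ^(γ+1)`. The mean moves by `-c z` up to a bias of order `r (h ∨ Δ)`, which vanishes
by assumption, and the second moment of the increment tends to zero.

Hence the normalized error `W` satisfies `W ≤ z` asymptotically iff `Z 0 ≤ c z`, that is `W = Z 0 /
c + o_P(1)` (`tendsto_measureReal_inversion`). The sums `Z 0` for the levels `τ_j` satisfy a joint
central limit theorem (`tendsto_charFun_triangularArray`) with covariance `g(x) ‖K‖₂² min(τ_i,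
τ_j)`, since overlapping exceedances are counted at the smaller level. Dividing by `c_i c_j`
produces the stated matrix, and Slutsky's lemma transfers the limit to `W`. -/

namespace ExtremalQuantile

/-! ### Von Mises survival functions and their extreme quantiles. -/

section Survival

variable {S : ℝ → ℝ} {γ : ℝ}

lemma pos_of_lt_rightEndpoint {y : ℝ} (hy : (y : EReal) < rightEndpoint S) : 0 < S y := by
  by_contra h
  have hle : rightEndpoint S ≤ (y : EReal) := sInf_le (mem_image_of_mem _ (not_lt.1 h))
  exact absurd hy (not_lt.2 hle)

lemma bot_lt_rightEndpoint (hS : Antitone S) {t : ℝ} (ht : 0 < S t) : ⊥ < rightEndpoint S := by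
  refine lt_of_lt_of_le (EReal.bot_lt_coe t) (le_sInf ?_)
  rintro _ ⟨y, hy, rfl⟩
  refine EReal.coe_le_coe_iff.2 (not_lt.1 fun h => ?_)
  have := hS h.le
  have hy' : S y ≤ 0 := hy
  linarith

/-- Treats finite and infinite endpoints at once: left neighbourhoods in `EReal` have a basis of
intervals, and density of the reals makes the lower bound real. An endpoint `⊥` has no left
neighbourhoods, hence `he`. -/
lemma eventually_leftOfEndpoint (he : ⊥ < rightEndpoint S) {P : ℝ → Prop} :
    (∀ᶠ y in leftOfEndpoint S, P y) ↔
      ∃ c : ℝ, (c : EReal) < rightEndpoint S ∧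
        ∀ y : ℝ, c < y → (y : EReal) < rightEndpoint S → P y := by
  rw [leftOfEndpoint, eventually_comap]
  constructor
  · intro h
    obtain ⟨a, ha, h⟩ := (mem_nhdsLT_iff_exists_Ioo_subset' he).1 h
    obtain ⟨c, hac, hc⟩ := EReal.lt_iff_exists_real_btwn.1 ha
    exact ⟨c, hc, fun y hcy hy => h ⟨hac.trans (EReal.coe_lt_coe_iff.2 hcy), hy⟩ y rfl⟩
  · rintro ⟨c, hc, h⟩
    refine (mem_nhdsLT_iff_exists_Ioo_subset' he).2 ⟨c, hc, ?_⟩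
    rintro _ ⟨h1, h2⟩ y rfl
    exact h y (EReal.coe_lt_coe_iff.1 h1) h2

lemma leftOfEndpoint_neBot (he : ⊥ < rightEndpoint S) : (leftOfEndpoint S).NeBot := by
  refine ⟨fun h => ?_⟩
  have : ∀ᶠ y in leftOfEndpoint S, False := by rw [h]; exact eventually_bot
  obtain ⟨c, hc, h⟩ := (eventually_leftOfEndpoint he).1 this
  obtain ⟨y, hcy, hy⟩ := EReal.lt_iff_exists_real_btwn.1 hc
  exact h y (EReal.coe_lt_coe_iff.1 hcy) hy

/-- Left of the endpoint, a von Mises survival function is regular and strictly decreasing. -/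
lemma VonMises.exists_regular (hV : VonMises S γ) (hS : Antitone S) (he : ⊥ < rightEndpoint S) :
    ∃ a : ℝ, (a : EReal) < rightEndpoint S ∧ ∀ y : ℝ, a < y → (y : EReal) < rightEndpoint S →
      DifferentiableAt ℝ S y ∧ DifferentiableAt ℝ (deriv S) y ∧ deriv S y < 0 := by
  refine (eventually_leftOfEndpoint he).1 ?_
  filter_upwards [hV.twice_differentiable, hV.deriv_ne_zero] with y h1 h2
  exact ⟨h1.1, h1.2, lt_of_le_of_ne hS.deriv_nonpos h2⟩

/-- A strictly decreasing continuous branch of `S` is inverted by the upper quantile. -/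
lemma VonMises.upperQuantile_spec (hV : VonMises S γ) (hS : Antitone S)
    (he : ⊥ < rightEndpoint S) {a c : ℝ}
    (ha : ∀ y : ℝ, a < y → (y : EReal) < rightEndpoint S →
      DifferentiableAt ℝ S y ∧ DifferentiableAt ℝ (deriv S) y ∧ deriv S y < 0)
    (hac : a < c) (hc : (c : EReal) < rightEndpoint S) {β : ℝ} (hβ : 0 < β) (hβc : β < S c) :
    S (upperQuantile S β) = β ∧ c < upperQuantile S β ∧
      ((upperQuantile S β : ℝ) : EReal) < rightEndpoint S := by
  have hne := leftOfEndpoint_neBot he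
  have hgt : ∀ᶠ y in leftOfEndpoint S, c < y ∧ (y : EReal) < rightEndpoint S :=
    (eventually_leftOfEndpoint he).2 ⟨c, hc, fun y h1 h2 => ⟨h1, h2⟩⟩
  -- Absence of an atom gives a point `b` beyond `c` where `S` is already below `β`; the
  -- intermediate value theorem then applies on `[c, b]`.
  obtain ⟨b, hSb, hcb, hb⟩ := ((hV.no_atom.eventually (gt_mem_nhds hβ)).and hgt).exists
  have hlt : ∀ y, y ≤ b → (y : EReal) < rightEndpoint S := fun y hy =>
    lt_of_le_of_lt (EReal.coe_le_coe_iff.2 hy) hb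
  have hcont : ContinuousOn S (Icc c b) := fun y hy =>
    (ha y (hac.trans_le hy.1) (hlt y hy.2)).1.continuousAt.continuousWithinAt
  have hanti : StrictAntiOn S (Icc c b) := by
    refine strictAntiOn_of_deriv_neg (convex_Icc c b) hcont fun y hy => ?_
    rw [interior_Icc] at hy
    exact (ha y (hac.trans hy.1) (hlt y hy.2.le)).2.2
  obtain ⟨y, hy, hSy⟩ := intermediate_value_Icc' hcb.le hcont ⟨hSb.le, hβc.le⟩
  have hcy : c < y := lt_of_le_of_ne hy.1 (by rintro rfl; exact hβc.ne' hSy)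
  -- Left of `c` the function stays above `β` by monotonicity, and on `[c, b]` it is strictly
  -- decreasing, so the infimum is attained at `y`.
  have hleast : IsLeast {t : ℝ | S t ≤ β} y := by
    refine ⟨hSy.le, fun t ht => not_lt.1 fun hty => ?_⟩
    have ht' : S t ≤ β := ht
    rcases le_or_gt c t with h | h
    · have := hanti ⟨h, hty.le.trans hy.2⟩ hy hty
      linarith
    · have := hS h.le
      linarith
  have hq : upperQuantile S β = y := hleast.csInf_eq
  rw [hq]
  exact ⟨hSy, hcy, hlt y hy.2⟩

lemma VonMises.tendsto_upperQuantile (hV : VonMises S γ) (hS : Antitone S)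
    (he : ⊥ < rightEndpoint S) :
    Tendsto (upperQuantile S) (𝓝[>] 0) (leftOfEndpoint S) := by
  obtain ⟨a, ha, hreg⟩ := hV.exists_regular hS he
  intro U hU
  obtain ⟨c, hc, h⟩ := (eventually_leftOfEndpoint he).1 hU
  have hm : ((max a c : ℝ) : EReal) < rightEndpoint S := by
    rcases max_choice a c with h | h <;> rw [h] <;> assumption
  obtain ⟨d, hd, hde⟩ := EReal.lt_iff_exists_real_btwn.1 hm
  have hd' := EReal.coe_lt_coe_iff.1 hd
  rw [mem_map]
  filter_upwards [Ioo_mem_nhdsGT (pos_of_lt_rightEndpoint hde)] with β hβ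
  obtain ⟨-, h1, h2⟩ :=
    hV.upperQuantile_spec hS he hreg ((le_max_left _ _).trans_lt hd') hde hβ.1 hβ.2
  exact h _ ((le_max_right a c).trans_lt (hd'.trans h1)) h2

lemma VonMises.eventually_apply_upperQuantile (hV : VonMises S γ) (hS : Antitone S)
    (he : ⊥ < rightEndpoint S) : ∀ᶠ β in 𝓝[>] 0, S (upperQuantile S β) = β := by
  obtain ⟨a, ha, hreg⟩ := hV.exists_regular hS he
  obtain ⟨d, hd, hde⟩ := EReal.lt_iff_exists_real_btwn.1 ha
  filter_upwards [Ioo_mem_nhdsGT (pos_of_lt_rightEndpoint hde)] with β hβ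
  exact (hV.upperQuantile_spec hS he hreg (EReal.coe_lt_coe_iff.1 hd) hde hβ.1 hβ.2).1

/-- Lets the unspecified points of the mean value theorems inherit convergence to the endpoint. -/
lemma tendsto_leftOfEndpoint_of_mem_uIcc {ι : Type*} {l : Filter ι} (he : ⊥ < rightEndpoint S)
    {u v ξ : ι → ℝ} (hu : Tendsto u l (leftOfEndpoint S)) (hv : Tendsto v l (leftOfEndpoint S))
    (hξ : ∀ᶠ i in l, ξ i ∈ uIcc (u i) (v i)) : Tendsto ξ l (leftOfEndpoint S) := by
  intro U hU
  obtain ⟨c, hc, h⟩ := (eventually_leftOfEndpoint he).1 hU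
  have hgt : ∀ᶠ y in leftOfEndpoint S, c < y ∧ (y : EReal) < rightEndpoint S :=
    (eventually_leftOfEndpoint he).2 ⟨c, hc, fun y h1 h2 => ⟨h1, h2⟩⟩
  rw [mem_map]
  filter_upwards [hu.eventually hgt, hv.eventually hgt, hξ] with i h1 h2 h3
  refine h _ (lt_of_lt_of_le (lt_min h1.1 h2.1) h3.1) ?_
  refine lt_of_le_of_lt (EReal.coe_le_coe_iff.2 h3.2) ?_
  rcases max_choice (u i) (v i) with h | h <;> rw [h]
  exacts [h1.2, h2.2]

/-- The derivative of a von Mises survival function varies regularly with the function. -/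
lemma VonMises.exists_log_ratio_eq (hV : VonMises S γ) (hS : Antitone S)
    (he : ⊥ < rightEndpoint S) :
    ∃ a : ℝ, (a : EReal) < rightEndpoint S ∧ ∀ u v : ℝ, a < u → a < v →
      (u : EReal) < rightEndpoint S → (v : EReal) < rightEndpoint S → ∃ ξ ∈ uIcc u v,
        Real.log (-deriv S u) - Real.log (-deriv S v) =
          (S ξ * deriv (deriv S) ξ / (deriv S ξ) ^ 2) * (Real.log (S u) - Real.log (S v)) := by
  obtain ⟨a, ha, hreg⟩ := hV.exists_regular hS he
  refine ⟨a, ha, ?_⟩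
  have key : ∀ u v : ℝ, a < u → u < v → (v : EReal) < rightEndpoint S → ∃ ξ ∈ uIcc u v,
      Real.log (-deriv S v) - Real.log (-deriv S u) =
        (S ξ * deriv (deriv S) ξ / (deriv S ξ) ^ 2) * (Real.log (S v) - Real.log (S u)) := by
    intro u v hau huv hv
    have hlt : ∀ y, y ≤ v → (y : EReal) < rightEndpoint S := fun y hy =>
      lt_of_le_of_lt (EReal.coe_le_coe_iff.2 hy) hv
    have d1 : ∀ y ∈ Icc u v, HasDerivAt (fun y => Real.log (S y)) (deriv S y / S y) y :=
      fun y hy => ((hreg y (hau.trans_le hy.1) (hlt y hy.2)).1.hasDerivAt).log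
        (pos_of_lt_rightEndpoint (hlt y hy.2)).ne'
    have d2 : ∀ y ∈ Icc u v, HasDerivAt (fun y => Real.log (-deriv S y))
        (-deriv (deriv S) y / -deriv S y) y := fun y hy =>
      ((hreg y (hau.trans_le hy.1) (hlt y hy.2)).2.1.hasDerivAt).neg.log
        (neg_ne_zero.2 (hreg y (hau.trans_le hy.1) (hlt y hy.2)).2.2.ne)
    -- Cauchy's mean value theorem for the pair `log S`, `log (-S')`: the ratio of derivatives
    -- `(S''/S') / (S'/S)` is the von Mises quotient.
    obtain ⟨ξ, hξ, h⟩ := exists_ratio_hasDerivAt_eq_ratio_slope _ _ huv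
      (fun y hy => (d1 y hy).continuousAt.continuousWithinAt)
      (fun y hy => d1 y (Ioo_subset_Icc_self hy)) _ _
      (fun y hy => (d2 y hy).continuousAt.continuousWithinAt)
      (fun y hy => d2 y (Ioo_subset_Icc_self hy))
    refine ⟨ξ, by rw [uIcc_of_le huv.le]; exact Ioo_subset_Icc_self hξ, ?_⟩
    have h1 := (hreg ξ (hau.trans hξ.1) (hlt ξ hξ.2.le)).2.2.ne
    have h2 := (pos_of_lt_rightEndpoint (hlt ξ hξ.2.le)).ne'
    rw [← div_left_inj' (div_ne_zero h1 h2), mul_div_assoc, div_self (div_ne_zero h1 h2),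
      mul_one] at h
    rw [h]
    field_simp
  intro u v hu hv hue hve
  rcases lt_trichotomy u v with h | rfl | h
  · obtain ⟨ξ, hξ, hh⟩ := key u v hu h hve
    exact ⟨ξ, hξ, by linarith⟩
  · exact ⟨u, by simp, by simp⟩
  · obtain ⟨ξ, hξ, hh⟩ := key v u hv h hue
    exact ⟨ξ, by rwa [uIcc_comm], hh⟩

/-- Exponentiates the mean value identity: the von Mises quotient at the intermediate point tends to
`γ + 1`, and `log` of the survival ratio tends to `log τ`. -/
lemma VonMises.tendsto_deriv_ratio {ι : Type*} {l : Filter ι} (hV : VonMises S γ)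
    (hS : Antitone S) (he : ⊥ < rightEndpoint S) {u v : ι → ℝ} {τ : ℝ} (hτ : 0 < τ)
    (hu : Tendsto u l (leftOfEndpoint S)) (hv : Tendsto v l (leftOfEndpoint S))
    (h : Tendsto (fun i => S (u i) / S (v i)) l (𝓝 τ)) :
    Tendsto (fun i => deriv S (u i) / deriv S (v i)) l (𝓝 (τ ^ (γ + 1))) := by
  obtain ⟨a, ha, hlog⟩ := hV.exists_log_ratio_eq hS he
  obtain ⟨b, hb, hreg⟩ := hV.exists_regular hS he
  have hgt : ∀ᶠ y in leftOfEndpoint S, (a < y ∧ (y : EReal) < rightEndpoint S) ∧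
      b < y :=
    ((eventually_leftOfEndpoint he).2 ⟨a, ha, fun y h1 h2 => ⟨h1, h2⟩⟩).and
      ((eventually_leftOfEndpoint he).2 ⟨b, hb, fun y h1 _ => h1⟩)
  -- The conclusion is guarded by its range conditions, so that `ξ` can be chosen for every index;
  -- where they fail its value is irrelevant.
  have hex : ∀ i, ∃ ξ, ((a < u i ∧ a < v i ∧ (u i : EReal) < rightEndpoint S ∧
      (v i : EReal) < rightEndpoint S) → ξ ∈ uIcc (u i) (v i) ∧
      Real.log (-deriv S (u i)) - Real.log (-deriv S (v i)) =
        (S ξ * deriv (deriv S) ξ / (deriv S ξ) ^ 2) *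
          (Real.log (S (u i)) - Real.log (S (v i)))) := by
    intro i
    by_cases hi : (a < u i ∧ a < v i ∧ (u i : EReal) < rightEndpoint S ∧
      (v i : EReal) < rightEndpoint S)
    · obtain ⟨ξ, h1, h2⟩ := hlog _ _ hi.1 hi.2.1 hi.2.2.1 hi.2.2.2
      exact ⟨ξ, fun _ => ⟨h1, h2⟩⟩
    · exact ⟨0, fun h => absurd h hi⟩
  choose ξ hξ using hex
  have hev := (hu.eventually hgt).and (hv.eventually hgt)
  have hξ' : Tendsto ξ l (leftOfEndpoint S) := tendsto_leftOfEndpoint_of_mem_uIcc he hu hv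
    (hev.mono fun i hi => (hξ i ⟨hi.1.1.1, hi.2.1.1, hi.1.1.2, hi.2.1.2⟩).1)
  have hlim : Tendsto (fun i => Real.exp
      ((S (ξ i) * deriv (deriv S) (ξ i) / (deriv S (ξ i)) ^ 2) *
        Real.log (S (u i) / S (v i)))) l (𝓝 (τ ^ (γ + 1))) := by
    rw [Real.rpow_def_of_pos hτ, mul_comm]
    exact (Real.continuous_exp.tendsto _).comp
      ((hV.limit.comp hξ').mul ((Real.continuousAt_log hτ.ne').tendsto.comp h))
  refine hlim.congr' (hev.mono fun i hi => ?_)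
  have h1 := (hξ i ⟨hi.1.1.1, hi.2.1.1, hi.1.1.2, hi.2.1.2⟩).2
  have hu' := (hreg _ hi.1.2 hi.1.1.2).2.2
  have hv' := (hreg _ hi.2.2 hi.2.1.2).2.2
  rw [Real.log_div (pos_of_lt_rightEndpoint hi.1.1.2).ne' (pos_of_lt_rightEndpoint hi.2.1.2).ne',
    ← h1, ← Real.log_div (neg_ne_zero.2 hu'.ne) (neg_ne_zero.2 hv'.ne), neg_div_neg_eq,
    Real.exp_log (div_pos_of_neg_of_neg hu' hv')]

/-- Local expansion of the upper quantile function at extreme levels. -/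
lemma VonMises.tendsto_upperQuantile_sub {ι : Type*} {l : Filter ι} (hV : VonMises S γ)
    (hS : Antitone S) (he : ⊥ < rightEndpoint S) {α r : ι → ℝ} {τ z : ℝ} (hτ : 0 < τ)
    (hα0 : ∀ i, 0 < α i) (hα : Tendsto α l (𝓝 0)) (hr0 : ∀ᶠ i in l, 0 < r i)
    (hr : Tendsto (fun i => (r i)⁻¹) l (𝓝 0)) :
    Tendsto (fun i => -deriv S (upperQuantile S (α i)) * (r i / α i) *
      (upperQuantile S (τ * α i * (1 - τ ^ γ * z / r i)) - upperQuantile S (τ * α i)))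
      l (𝓝 z) := by
  -- The shift is calibrated so that `β - τα = -τ^(γ+1) α z / r`; the factor `τ^(γ+1)` cancels the
  -- limit of the derivative ratio between levels `τα` and `α`.
  set β : ι → ℝ := fun i => τ * α i * (1 - τ ^ γ * z / r i) with hβdef
  have hfac : Tendsto (fun i => 1 - τ ^ γ * z / r i) l (𝓝 1) := by
    simpa [div_eq_mul_inv] using (tendsto_const_nhds (x := (1 : ℝ))).sub
      ((tendsto_const_nhds (x := τ ^ γ * z)).mul hr)
  have hα' : Tendsto α l (𝓝[>] 0) :=
    tendsto_nhdsWithin_iff.2 ⟨hα, Eventually.of_forall hα0⟩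
  have hτα : Tendsto (fun i => τ * α i) l (𝓝[>] 0) :=
    tendsto_nhdsWithin_iff.2 ⟨by simpa using hα.const_mul τ,
      Eventually.of_forall fun i => mul_pos hτ (hα0 i)⟩
  have hβ : Tendsto β l (𝓝[>] 0) := by
    refine tendsto_nhdsWithin_iff.2 ⟨by simpa using (hα.const_mul τ).mul hfac, ?_⟩
    filter_upwards [hfac.eventually (lt_mem_nhds (zero_lt_one))] with i hi
    exact mul_pos (mul_pos hτ (hα0 i)) hi
  obtain ⟨b, hb, hreg⟩ := hV.exists_regular hS he
  have hq := hV.tendsto_upperQuantile hS he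
  have hgt : ∀ᶠ y in leftOfEndpoint S, b < y ∧ (y : EReal) < rightEndpoint S :=
    (eventually_leftOfEndpoint he).2 ⟨b, hb, fun y h1 h2 => ⟨h1, h2⟩⟩
  have hex : ∀ i, ∃ ξ, ((b < upperQuantile S (β i) ∧
      (upperQuantile S (β i) : EReal) < rightEndpoint S) →
      (b < upperQuantile S (τ * α i) ∧
      (upperQuantile S (τ * α i) : EReal) < rightEndpoint S) →
      ξ ∈ uIcc (upperQuantile S (β i)) (upperQuantile S (τ * α i)) ∧
      S (upperQuantile S (β i)) - S (upperQuantile S (τ * α i)) =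
        deriv S ξ * (upperQuantile S (β i) - upperQuantile S (τ * α i))) := by
    intro i
    have key : ∀ u v : ℝ, b < u → u < v → (v : EReal) < rightEndpoint S → ∃ ξ ∈ uIcc u v,
        S v - S u = deriv S ξ * (v - u) := by
      intro u v hu huv hv
      have hd : ∀ y ∈ Icc u v, DifferentiableAt ℝ S y := fun y hy =>
        (hreg y (hu.trans_le hy.1) (lt_of_le_of_lt (EReal.coe_le_coe_iff.2 hy.2) hv)).1
      obtain ⟨ξ, hξ, h⟩ := exists_deriv_eq_slope S huv
        (fun y hy => (hd y hy).continuousAt.continuousWithinAt)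
        (fun y hy => (hd y (Ioo_subset_Icc_self hy)).differentiableWithinAt)
      refine ⟨ξ, by rw [uIcc_of_le huv.le]; exact Ioo_subset_Icc_self hξ, ?_⟩
      rw [h, div_mul_cancel₀ _ (sub_pos.2 huv).ne']
    by_cases h : (b < upperQuantile S (β i) ∧
      (upperQuantile S (β i) : EReal) < rightEndpoint S) ∧ (b < upperQuantile S (τ * α i) ∧
      (upperQuantile S (τ * α i) : EReal) < rightEndpoint S)
    · rcases lt_trichotomy (upperQuantile S (β i)) (upperQuantile S (τ * α i)) with h' | h' | h'
      · obtain ⟨ξ, h1, h2⟩ := key _ _ h.1.1 h' h.2.2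
        exact ⟨ξ, fun _ _ => ⟨h1, by linarith⟩⟩
      · exact ⟨upperQuantile S (β i), fun _ _ => ⟨by simp, by simp [h']⟩⟩
      · obtain ⟨ξ, h1, h2⟩ := key _ _ h.2.1 h' h.1.2
        exact ⟨ξ, fun _ _ => ⟨by rwa [uIcc_comm], h2⟩⟩
    · exact ⟨0, fun h1 h2 => absurd ⟨h1, h2⟩ h⟩
  choose ξ hξ using hex
  have hev := ((hq.comp hβ).eventually hgt).and ((hq.comp hτα).eventually hgt)
  have hξ' : Tendsto ξ l (leftOfEndpoint S) :=
    tendsto_leftOfEndpoint_of_mem_uIcc he (hq.comp hβ) (hq.comp hτα)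
      (hev.mono fun i hi => (hξ i hi.1 hi.2).1)
  have hinv := hV.eventually_apply_upperQuantile hS he
  -- Only the position of `ξ` between the two quantiles is known, but `S ξ` is then squeezed between
  -- the levels `β` and `τα`, both equivalent to `τα`.
  have hSξ : Tendsto (fun i => S (ξ i) / S (upperQuantile S (α i))) l (𝓝 τ) := by
    have h1 : Tendsto (fun i => min (β i) (τ * α i) / α i) l (𝓝 τ) := by
      have : Tendsto (fun i => min (τ * (1 - τ ^ γ * z / r i)) τ) l (𝓝 τ) := by
        simpa using (hfac.const_mul τ).min (tendsto_const_nhds (x := τ))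
      refine this.congr fun i => ?_
      rw [eq_div_iff (hα0 i).ne', min_mul_of_nonneg _ _ (hα0 i).le, hβdef]
      ring_nf
    have h2 : Tendsto (fun i => max (β i) (τ * α i) / α i) l (𝓝 τ) := by
      have : Tendsto (fun i => max (τ * (1 - τ ^ γ * z / r i)) τ) l (𝓝 τ) := by
        simpa using (hfac.const_mul τ).max (tendsto_const_nhds (x := τ))
      refine this.congr fun i => ?_
      rw [eq_div_iff (hα0 i).ne', max_mul_of_nonneg _ _ (hα0 i).le, hβdef]
      ring_nf
    have hboth : ∀ᶠ i in l, min (β i) (τ * α i) ≤ S (ξ i) ∧ S (ξ i) ≤ max (β i) (τ * α i) ∧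
        S (upperQuantile S (α i)) = α i := by
      filter_upwards [hev, hβ.eventually hinv, hτα.eventually hinv, hα'.eventually hinv]
        with i hi e1 e2 e3
      have hm := (hξ i hi.1 hi.2).1
      refine ⟨?_, ?_, e3⟩
      · rcases max_choice (upperQuantile S (β i)) (upperQuantile S (τ * α i)) with hc | hc
        · exact (min_le_left _ _).trans (e1 ▸ hS (hc ▸ hm.2))
        · exact (min_le_right _ _).trans (e2 ▸ hS (hc ▸ hm.2))
      · rcases min_choice (upperQuantile S (β i)) (upperQuantile S (τ * α i)) with hc | hc
        · exact (e1 ▸ hS (hc ▸ hm.1) : S (ξ i) ≤ β i).trans (le_max_left _ _)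
        · exact (e2 ▸ hS (hc ▸ hm.1) : S (ξ i) ≤ τ * α i).trans (le_max_right _ _)
    refine tendsto_of_tendsto_of_tendsto_of_le_of_le' h1 h2 ?_ ?_
    · filter_upwards [hboth] with i hi
      rw [hi.2.2]
      exact div_le_div_of_nonneg_right hi.1 (hα0 i).le
    · filter_upwards [hboth] with i hi
      rw [hi.2.2]
      exact div_le_div_of_nonneg_right hi.2.1 (hα0 i).le
  have hratio := hV.tendsto_deriv_ratio hS he hτ hξ' (hq.comp hα') hSξ
  have hτγ : 0 < τ ^ (γ + 1) := Real.rpow_pos_of_pos hτ _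
  have hlim : Tendsto (fun i =>
      τ ^ (γ + 1) * z / (deriv S (ξ i) / deriv S (upperQuantile S (α i)))) l (𝓝 z) := by
    have := (tendsto_const_nhds (x := τ ^ (γ + 1) * z)).div hratio hτγ.ne'
    rwa [mul_div_cancel_left₀ _ hτγ.ne'] at this
  refine hlim.congr' ?_
  filter_upwards [hev, hβ.eventually hinv, hτα.eventually hinv, (hq.comp hα').eventually hgt,
    hξ'.eventually hgt, hr0] with i hi e1 e2 e3 e4 hri
  have h1 := (hξ i hi.1 hi.2).2
  rw [e1, e2] at h1
  have n1 := (hreg _ e4.1 e4.2).2.2.ne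
  have n2 : deriv S (upperQuantile S (α i)) ≠ 0 := (hreg _ e3.1 e3.2).2.2.ne
  have h3 : upperQuantile S (β i) - upperQuantile S (τ * α i) =
      (β i - τ * α i) / deriv S (ξ i) := by
    rw [h1]; field_simp
  have hα0' := (hα0 i).ne'
  rw [h3, Real.rpow_add hτ, Real.rpow_one]
  simp only [hβdef]
  field_simp
  ring

end Survival

/-! ### Limit theorems for triangular arrays, and inversion in probability. -/

section TriangularArray

variable {Ω E : Type*} [MeasurableSpace Ω] {P : Measure Ω} [MeasurableSpace E] {ν : Measure E}
  {D : ℕ → Ω → E}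

lemma charFun_sum_comp (hDm : ∀ i, Measurable (D i)) (hD : iIndepFun D P)
    (hν : ∀ i, P.map (D i) = ν) {φ : E → ℝ} (hφ : Measurable φ) (n : ℕ) :
    charFun (P.map fun ω => ∑ i ∈ Finset.range n, φ (D i ω)) 1 =
      (∫ e, Complex.exp (φ e * Complex.I) ∂ν) ^ n := by
  have h1 : iIndepFun (fun i ω => φ (D i ω)) P := hD.comp (fun _ => φ) (fun _ => hφ)
  rw [(h1.restrict _).charFun_map_fun_finsetSum_eq_prod (X := fun i ω => φ (D i ω))
    (fun i _ => (hφ.comp (hDm i)).aemeasurable)]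
  have h2 : ∀ i, P.map (fun ω => φ (D i ω)) = ν.map φ := fun i => by
    rw [← hν i, Measure.map_map hφ (hDm i)]; rfl
  rw [Finset.prod_apply]
  simp only [h2, Finset.prod_const, Finset.card_range]
  rw [charFun_apply_real, integral_map hφ.aemeasurable (by fun_prop)]
  simp

/-- For entries bounded by `C n → 0`, the cubic remainder is at most `C n` times the second moment,
which takes the place of a Lindeberg condition. -/
lemma norm_exp_mul_I_sub_le {x : ℝ} (hx : |x| ≤ 1) :
    ‖Complex.exp (x * Complex.I) - 1 - (x * Complex.I - (x ^ 2 / 2 : ℝ))‖ ≤ |x| ^ 3 := by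
  have hn : ‖(x : ℂ) * Complex.I‖ = |x| := by simp
  have h := Complex.exp_bound (x := x * Complex.I) (by rwa [hn]) (n := 3) (by norm_num)
  rw [hn] at h
  have e : Complex.exp (x * Complex.I) - 1 - (x * Complex.I - (x ^ 2 / 2 : ℝ)) =
      Complex.exp (x * Complex.I) -
        ∑ m ∈ Finset.range 3, ((x : ℂ) * Complex.I) ^ m / (m.factorial : ℂ) := by
    simp [Finset.sum_range_succ, mul_pow, Nat.factorial]
    ring
  rw [e]
  refine h.trans ?_
  have : (0 : ℝ) ≤ |x| ^ 3 := by positivity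
  norm_num [Nat.factorial]
  nlinarith

variable [IsProbabilityMeasure P]

/-- Central limit theorem for row-wise i.i.d. triangular arrays with uniformly small entries. -/
lemma tendsto_charFun_triangularArray (hDm : ∀ i, Measurable (D i)) (hD : iIndepFun D P)
    (hν : ∀ i, P.map (D i) = ν) {φ : ℕ → E → ℝ} (hφ : ∀ n, Measurable (φ n)) {C : ℕ → ℝ}
    (hC : ∀ᶠ n in atTop, ∀ e, |φ n e| ≤ C n) (hC0 : Tendsto C atTop (𝓝 0)) {v : ℝ}
    (h1 : Tendsto (fun n : ℕ => n * ∫ e, φ n e ∂ν) atTop (𝓝 0))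
    (h2 : Tendsto (fun n : ℕ => n * ∫ e, φ n e ^ 2 ∂ν) atTop (𝓝 v)) :
    Tendsto (fun n => charFun (P.map fun ω => ∑ i ∈ Finset.range n, φ n (D i ω)) 1) atTop
      (𝓝 (Complex.exp (-(v / 2 : ℝ)))) := by
  have : IsProbabilityMeasure ν := hν 0 ▸ Measure.isProbabilityMeasure_map (hDm 0).aemeasurable
  simp_rw [fun n => charFun_sum_comp hDm hD hν (hφ n) n]
  -- The characteristic function is an `n`-th power, so it suffices that `n` times its base minus
  -- one converges to `-v/2`.
  have hg : Tendsto (fun n : ℕ => (n : ℂ) * ((∫ e, Complex.exp (φ n e * Complex.I) ∂ν) - 1)) atTop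
      (𝓝 (-(v / 2 : ℝ))) := by
    have hmain : Tendsto (fun n : ℕ => (((n * ∫ e, φ n e ∂ν : ℝ) : ℂ) * Complex.I -
        ((n * ∫ e, φ n e ^ 2 ∂ν) / 2 : ℝ))) atTop (𝓝 (-(v / 2 : ℝ))) := by
      have a1 := ((Complex.continuous_ofReal.tendsto _).comp h1).mul_const Complex.I
      have a2 := (Complex.continuous_ofReal.tendsto _).comp (h2.div_const 2)
      simpa using a1.sub a2
    refine tendsto_of_tendsto_of_dist hmain ?_
    have hbound : Tendsto (fun n : ℕ => C n * (n * ∫ e, φ n e ^ 2 ∂ν)) atTop (𝓝 0) := by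
      simpa using hC0.mul h2
    refine squeeze_zero' (Eventually.of_forall fun n => dist_nonneg) ?_ hbound
    filter_upwards [hC, hC0.eventually (gt_mem_nhds zero_lt_one)] with n hn hn1
    have hint : Integrable (φ n) ν :=
      Integrable.of_bound (hφ n).aestronglyMeasurable (C n) (ae_of_all _ hn)
    have hint2 : Integrable (fun e => φ n e ^ 2) ν := by
      refine Integrable.of_bound ((hφ n).pow_const 2).aestronglyMeasurable (C n ^ 2)
        (ae_of_all _ fun e => ?_)
      rw [norm_pow]
      exact pow_le_pow_left₀ (norm_nonneg _) (hn e) 2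
    have hexp : Integrable (fun e => Complex.exp (φ n e * Complex.I)) ν := by
      refine Integrable.of_bound (by have := hφ n; fun_prop) 1 (ae_of_all _ fun e => ?_)
      rw [Complex.norm_exp_ofReal_mul_I]
    have hint' : Integrable (fun e => (φ n e : ℂ) * Complex.I) ν := hint.ofReal.mul_const _
    have hint2' : Integrable (fun e => ((φ n e ^ 2 / 2 : ℝ) : ℂ)) ν := (hint2.div_const 2).ofReal
    have e1 : (n : ℂ) * ((∫ e, Complex.exp (φ n e * Complex.I) ∂ν) - 1) -
        (((n * ∫ e, φ n e ∂ν : ℝ) : ℂ) * Complex.I - ((n * ∫ e, φ n e ^ 2 ∂ν) / 2 : ℝ)) =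
        n * ∫ e, (Complex.exp (φ n e * Complex.I) - 1 -
          (φ n e * Complex.I - (φ n e ^ 2 / 2 : ℝ))) ∂ν := by
      rw [integral_sub (f := fun e => Complex.exp (φ n e * Complex.I) - 1)
          (g := fun e => (φ n e : ℂ) * Complex.I - (φ n e ^ 2 / 2 : ℝ))
          (hexp.sub (integrable_const 1)) (hint'.sub hint2'),
        integral_sub hexp (integrable_const 1), integral_sub hint' hint2', integral_mul_const,
        integral_complex_ofReal, integral_complex_ofReal, integral_div]
      simp
      ring
    rw [dist_comm, dist_eq_norm, e1, norm_mul, Complex.norm_natCast]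
    have : ‖∫ e, (Complex.exp (φ n e * Complex.I) - 1 -
          (φ n e * Complex.I - (φ n e ^ 2 / 2 : ℝ))) ∂ν‖ ≤ ∫ e, C n * φ n e ^ 2 ∂ν := by
      refine norm_integral_le_of_norm_le (hint2.const_mul _) (ae_of_all _ fun e => ?_)
      refine (norm_exp_mul_I_sub_le ((hn e).trans hn1.le)).trans ?_
      rw [pow_succ', sq_abs]
      exact mul_le_mul_of_nonneg_right (hn e) (sq_nonneg _)
    calc (n : ℝ) * _ ≤ n * ∫ e, C n * φ n e ^ 2 ∂ν := by gcongr
      _ = C n * (n * ∫ e, φ n e ^ 2 ∂ν) := by rw [integral_const_mul]; ring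
  have := Complex.tendsto_one_add_pow_exp_of_tendsto hg
  simpa using this

/-- Chebyshev's inequality for sums of i.i.d. bounded random variables, around any centre. -/
lemma measureReal_le_abs_sum_sub_le (hDm : ∀ i, Measurable (D i)) (hD : iIndepFun D P)
    (hν : ∀ i, P.map (D i) = ν) {φ : E → ℝ} (hφ : Measurable φ) {C : ℝ} (hC : ∀ e, |φ e| ≤ C)
    (n : ℕ) (m : ℝ) {ε : ℝ} (hε : 0 < ε) :
    P.real {ω | ε ≤ |∑ i ∈ Finset.range n, φ (D i ω) - m|} ≤
      (n * ∫ e, φ e ^ 2 ∂ν + (n * ∫ e, φ e ∂ν - m) ^ 2) / ε ^ 2 := by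
  have hmeas : ∀ i, Measurable fun ω => φ (D i ω) := fun i => hφ.comp (hDm i)
  have hmem : ∀ i, MemLp (fun ω => φ (D i ω)) 2 P := fun i =>
    MemLp.of_bound (hmeas i).aestronglyMeasurable C (ae_of_all _ fun ω => hC _)
  have hmemS : MemLp (fun ω => ∑ i ∈ Finset.range n, φ (D i ω)) 2 P :=
    memLp_finsetSum _ fun i _ => hmem i
  have hE : ∀ i, ∫ ω, φ (D i ω) ∂P = ∫ e, φ e ∂ν := fun i => by
    rw [← hν i, integral_map (hDm i).aemeasurable hφ.aestronglyMeasurable]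
  have hE2 : ∀ i, ∫ ω, φ (D i ω) ^ 2 ∂P = ∫ e, φ e ^ 2 ∂ν := fun i => by
    rw [← hν i, integral_map (hDm i).aemeasurable (hφ.pow_const 2).aestronglyMeasurable]
  have hES : ∫ ω, ∑ i ∈ Finset.range n, φ (D i ω) ∂P = n * ∫ e, φ e ∂ν := by
    rw [integral_finsetSum _ fun i _ => (hmem i).integrable (by norm_num)]
    simp [hE]
  have hvar : Var[fun ω => ∑ i ∈ Finset.range n, φ (D i ω); P] ≤ n * ∫ e, φ e ^ 2 ∂ν := by
    have h := IndepFun.variance_sum (μ := P) (s := Finset.range n)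
      (X := fun i ω => φ (D i ω)) (fun i _ => hmem i)
      (fun i _ j _ hij => (hD.indepFun hij).comp hφ hφ)
    have e : (∑ i ∈ Finset.range n, fun ω => φ (D i ω)) =
        fun ω => ∑ i ∈ Finset.range n, φ (D i ω) := by ext; simp
    rw [e] at h
    rw [h]
    refine (Finset.sum_le_card_nsmul _ _ (∫ e, φ e ^ 2 ∂ν) fun i _ => ?_).trans (by simp)
    refine (variance_le_expectation_sq (hmeas i).aestronglyMeasurable).trans ?_
    simpa using (hE2 i).le
  have hsq : ∫ ω, (∑ i ∈ Finset.range n, φ (D i ω) - m) ^ 2 ∂P ≤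
      n * ∫ e, φ e ^ 2 ∂ν + (n * ∫ e, φ e ∂ν - m) ^ 2 := by
    have h := variance_eq_sub (hmemS.sub (memLp_const m))
    have h' : Var[fun ω => ∑ i ∈ Finset.range n, φ (D i ω) - m; P] =
        Var[fun ω => ∑ i ∈ Finset.range n, φ (D i ω); P] := variance_sub_const
          hmemS.aestronglyMeasurable m
    have e : ∫ ω, (∑ i ∈ Finset.range n, φ (D i ω) - m) ∂P = n * ∫ e, φ e ∂ν - m := by
      rw [integral_sub (hmemS.integrable (by norm_num)) (integrable_const m), hES]
      simp
    have h2 : Var[fun ω => ∑ i ∈ Finset.range n, φ (D i ω) - m; P] =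
      ∫ ω, (∑ i ∈ Finset.range n, φ (D i ω) - m) ^ 2 ∂P -
        (∫ ω, (∑ i ∈ Finset.range n, φ (D i ω) - m) ∂P) ^ 2 := h
    rw [e, h'] at h2
    linarith
  have hmark := mul_meas_ge_le_integral_of_nonneg (μ := P)
    (f := fun ω => (∑ i ∈ Finset.range n, φ (D i ω) - m) ^ 2)
    (ae_of_all _ fun ω => sq_nonneg _) ((hmemS.sub (memLp_const m)).integrable_sq) (ε ^ 2)
  have hset : {ω | ε ≤ |∑ i ∈ Finset.range n, φ (D i ω) - m|} =
      {ω | ε ^ 2 ≤ (∑ i ∈ Finset.range n, φ (D i ω) - m) ^ 2} := by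
    ext ω
    simp only [mem_ofPred_eq]
    rw [sq_le_sq, abs_of_pos hε]
  rw [hset, le_div_iff₀ (by positivity), mul_comm]
  exact hmark.trans hsq

/-- Weak law of large numbers for row-wise i.i.d. triangular arrays. -/
lemma tendsto_measureReal_triangularArray (hDm : ∀ i, Measurable (D i)) (hD : iIndepFun D P)
    (hν : ∀ i, P.map (D i) = ν) {φ : ℕ → E → ℝ} (hφ : ∀ n, Measurable (φ n)) {C : ℕ → ℝ}
    (hC : ∀ᶠ n in atTop, ∀ e, |φ n e| ≤ C n) {m : ℝ}
    (h1 : Tendsto (fun n : ℕ => n * ∫ e, φ n e ∂ν) atTop (𝓝 m))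
    (h2 : Tendsto (fun n : ℕ => n * ∫ e, φ n e ^ 2 ∂ν) atTop (𝓝 0)) {ε : ℝ} (hε : 0 < ε) :
    Tendsto (fun n => P.real {ω | ε ≤ |∑ i ∈ Finset.range n, φ n (D i ω) - m|}) atTop (𝓝 0) := by
  have h : Tendsto (fun n : ℕ => (n * ∫ e, φ n e ^ 2 ∂ν + (n * ∫ e, φ n e ∂ν - m) ^ 2) / ε ^ 2)
      atTop (𝓝 0) := by
    have := (h2.add ((h1.sub_const m).pow 2)).div_const (ε ^ 2)
    simpa using this
  refine squeeze_zero' (Eventually.of_forall fun n => measureReal_nonneg) ?_ h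
  filter_upwards [hC] with n hn
  exact measureReal_le_abs_sum_sub_le hDm hD hν (hφ n) hn n m hε

/-- Row sums with converging first two moments are tight. -/
lemma tight_triangularArray (hDm : ∀ i, Measurable (D i)) (hD : iIndepFun D P)
    (hν : ∀ i, P.map (D i) = ν) {φ : ℕ → E → ℝ} (hφ : ∀ n, Measurable (φ n)) {C : ℕ → ℝ}
    (hC : ∀ᶠ n in atTop, ∀ e, |φ n e| ≤ C n) {v : ℝ}
    (h1 : Tendsto (fun n : ℕ => n * ∫ e, φ n e ∂ν) atTop (𝓝 0))
    (h2 : Tendsto (fun n : ℕ => n * ∫ e, φ n e ^ 2 ∂ν) atTop (𝓝 v)) {η : ℝ} (hη : 0 < η) :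
    ∃ M : ℝ, ∀ᶠ n in atTop, P.real {ω | M ≤ |∑ i ∈ Finset.range n, φ n (D i ω)|} ≤ η := by
  have h : Tendsto (fun n : ℕ => (n * ∫ e, φ n e ^ 2 ∂ν + (n * ∫ e, φ n e ∂ν - 0) ^ 2))
      atTop (𝓝 v) := by
    simpa using h2.add ((h1.sub_const 0).pow 2)
  refine ⟨√((|v| + 1) / η), ?_⟩
  have hM : 0 < √((|v| + 1) / η) := Real.sqrt_pos.2 (by positivity)
  filter_upwards [hC, h.eventually (gt_mem_nhds (lt_of_le_of_lt (le_abs_self v) (lt_add_one _)))]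
    with n hn hv
  have := measureReal_le_abs_sum_sub_le hDm hD hν (hφ n) hn n 0 hM
  simp only [sub_zero] at this hv
  refine this.trans ?_
  rw [Real.sq_sqrt (by positivity), div_le_iff₀ (by positivity)]
  have e : η * ((|v| + 1) / η) = |v| + 1 := by field_simp
  rw [e]
  exact hv.le

end TriangularArray

/-- If `W ≤ z` is asymptotically equivalent to `Z z ≤ 0`, where `Z z = Z 0 - c z + o(1)` and `Z 0`
is tight, then `W = Z 0 / c + o(1)` in probability. -/
lemma tendsto_measureReal_inversion {Ω : Type*} [MeasurableSpace Ω] {P : Measure Ω}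
    [IsProbabilityMeasure P] {W : ℕ → Ω → ℝ} {Z : ℝ → ℕ → Ω → ℝ} {bad : ℕ → Set Ω} {c : ℝ}
    (hc : 0 < c) (hbad : Tendsto (fun n => P.real (bad n)) atTop (𝓝 0))
    (hZ : ∀ z, ∀ ε, 0 < ε → Tendsto (fun n => P.real {ω | ε ≤ |Z z n ω - Z 0 n ω + c * z|})
      atTop (𝓝 0))
    (htight : ∀ η, 0 < η → ∃ M : ℝ, ∀ᶠ n in atTop, P.real {ω | M ≤ |Z 0 n ω|} ≤ η)
    (hup : ∀ z δ, 0 < δ → ∀ᶠ n in atTop, ∀ ω, ω ∉ bad n → Z z n ω ≤ 0 → W n ω ≤ z + δ)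
    (hlo : ∀ z δ, 0 < δ → ∀ᶠ n in atTop, ∀ ω, ω ∉ bad n → 0 < Z z n ω → z - δ ≤ W n ω)
    {ε : ℝ} (hε : 0 < ε) :
    Tendsto (fun n => P.real {ω | ε ≤ |W n ω - Z 0 n ω / c|}) atTop (𝓝 0) := by
  -- A grid of mesh `d`: by tightness `Z 0 / c` stays in a bounded range, so finitely many `z`
  -- suffice and pointwise convergence in `z` is enough.
  set d : ℝ := ε / 4 with hd
  have hd0 : 0 < d := by positivity
  refine tendsto_order.2 ⟨fun a ha => Eventually.of_forall fun n =>
    ha.trans_le measureReal_nonneg, fun η hη => ?_⟩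
  obtain ⟨M, hM⟩ := htight (η / 2) (by positivity)
  -- The extra `3` leaves room for rounding `V / d` to an integer and moving one further step.
  obtain ⟨L, hL⟩ := exists_nat_gt (|M| / (c * d) + 3)
  have hcd : 0 < c * d := by positivity
  set G : Finset ℤ := Finset.Icc (-(L : ℤ)) L with hG
  have hsum : Tendsto (fun n => P.real (bad n) + ∑ k ∈ G, P.real
      {ω | c * d ≤ |Z (k * d) n ω - Z 0 n ω + c * (k * d)|}) atTop (𝓝 0) := by
    have := hbad.add (tendsto_finsetSum G fun (k : ℤ) _ => hZ (k * d) (c * d) hcd)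
    simpa using this
  have hup' : ∀ᶠ n in atTop, ∀ k ∈ G, ∀ ω, ω ∉ bad n → Z (k * d) n ω ≤ 0 → W n ω ≤ k * d + d :=
    (Filter.eventually_all_finset G).2 fun k _ => hup _ d hd0
  have hlo' : ∀ᶠ n in atTop, ∀ k ∈ G, ∀ ω, ω ∉ bad n → 0 < Z (k * d) n ω → k * d - d ≤ W n ω :=
    (Filter.eventually_all_finset G).2 fun k _ => hlo _ d hd0
  filter_upwards [hM, hup', hlo', hsum.eventually (gt_mem_nhds (half_pos hη))] with n h1 h2 h3 h4
  have hsub : {ω | ε ≤ |W n ω - Z 0 n ω / c|} ⊆ {ω | M ≤ |Z 0 n ω|} ∪ (bad n ∪ ⋃ k ∈ G,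
      {ω | c * d ≤ |Z (k * d) n ω - Z 0 n ω + c * (k * d)|}) := by
    intro ω hω
    by_contra hcon
    simp only [mem_union, mem_iUnion, mem_ofPred_eq, not_or, not_exists, not_le] at hcon
    obtain ⟨k1, k2, k3⟩ := hcon
    set V := Z 0 n ω / c with hV
    have hZV : Z 0 n ω = c * V := by rw [hV]; field_simp
    have hVL : |V / d| < L - 3 := by
      rw [abs_div, abs_div, abs_of_pos hc, abs_of_pos hd0, div_div]
      have : |Z 0 n ω| / (c * d) ≤ |M| / (c * d) := by
        exact div_le_div_of_nonneg_right (k1.le.trans (le_abs_self M)) hcd.le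
      linarith
    obtain ⟨hV1, hV2⟩ := abs_lt.1 hVL
    have hle : W n ω - V < ε := by
      -- The additional step gives `c (V - k d) ≤ -c d`, which absorbs the error below `c d` and
      -- makes `Z (k d) ≤ 0`. The cost is `W ≤ k d + d < V + 3 d < V + ε`.
      set k := ⌈V / d⌉ + 1 with hk
      have a1 : V / d ≤ ⌈V / d⌉ := Int.le_ceil _
      have a2 : (⌈V / d⌉ : ℝ) < V / d + 1 := Int.ceil_lt_add_one _
      have hkc : (k : ℝ) = ⌈V / d⌉ + 1 := by rw [hk]; push_cast; ring
      have hkG : k ∈ G := by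
        rw [hG, Finset.mem_Icc]
        constructor
        · have : (-(L : ℝ)) ≤ k := by rw [hkc]; linarith
          exact_mod_cast this
        · have : (k : ℝ) ≤ L := by rw [hkc]; linarith
          exact_mod_cast this
      have b := (abs_lt.1 (k3 k hkG)).2
      have e1 : V ≤ ⌈V / d⌉ * d := (div_le_iff₀ hd0).1 a1
      have e2 : (⌈V / d⌉ : ℝ) * d < V + d := by
        have := mul_lt_mul_of_pos_right a2 hd0
        rwa [add_mul, div_mul_cancel₀ _ hd0.ne', one_mul] at this
      have e3 : (k : ℝ) * d = ⌈V / d⌉ * d + d := by rw [hkc]; ring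
      have hz : Z (k * d) n ω ≤ 0 := by
        have : c * (V + d - k * d) ≤ 0 := mul_nonpos_of_nonneg_of_nonpos hc.le (by linarith)
        nlinarith
      have := h2 k hkG ω k2 hz
      linarith
    have hge : -ε < W n ω - V := by
      set k := ⌊V / d⌋ - 1 with hk
      have a1 : (⌊V / d⌋ : ℝ) ≤ V / d := Int.floor_le _
      have a2 : V / d < ⌊V / d⌋ + 1 := Int.lt_floor_add_one _
      have hkc : (k : ℝ) = ⌊V / d⌋ - 1 := by rw [hk]; push_cast; ring
      have hkG : k ∈ G := by
        rw [hG, Finset.mem_Icc]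
        constructor
        · have : (-(L : ℝ)) ≤ k := by rw [hkc]; linarith
          exact_mod_cast this
        · have : (k : ℝ) ≤ L := by rw [hkc]; linarith
          exact_mod_cast this
      have b := (abs_lt.1 (k3 k hkG)).1
      have e1 : ⌊V / d⌋ * d ≤ V := (le_div_iff₀ hd0).1 a1
      have e2 : V < (⌊V / d⌋ : ℝ) * d + d := by
        have := mul_lt_mul_of_pos_right a2 hd0
        rwa [add_mul, div_mul_cancel₀ _ hd0.ne', one_mul] at this
      have e3 : (k : ℝ) * d = ⌊V / d⌋ * d - d := by rw [hkc]; ring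
      have hz : 0 < Z (k * d) n ω := by
        have : 0 ≤ c * (V - d - k * d) := mul_nonneg hc.le (by linarith)
        nlinarith
      have := h3 k hkG ω k2 hz
      linarith
    exact absurd (show ε ≤ |W n ω - V| from hω) (not_le.2 (abs_lt.2 ⟨hge, hle⟩))
  calc P.real {ω | ε ≤ |W n ω - Z 0 n ω / c|}
      ≤ P.real {ω | M ≤ |Z 0 n ω|} + (P.real (bad n) + ∑ k ∈ G, P.real
        {ω | c * d ≤ |Z (k * d) n ω - Z 0 n ω + c * (k * d)|}) := by
        refine (measureReal_mono hsub).trans ((measureReal_union_le _ _).trans ?_)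
        gcongr
        refine (measureReal_union_le _ _).trans ?_
        gcongr
        exact measureReal_biUnion_finset_le _ _
    _ < η := by linarith

/-! ### Kernel moments under the joint law, and the standing assumptions. -/

section Moments

variable {p : ℕ} {Q : Kernel (Cov p) ℝ} [IsMarkovKernel Q] {g k : Cov p → ℝ} {x : Cov p}

/-- The joint law of a pair with covariate density `g` and conditional law `Q`. -/
noncomputable def pairLaw (g : Cov p → ℝ) (Q : Kernel (Cov p) ℝ) : Measure (Cov p × ℝ) :=
  (volume.withDensity (fun z => ENNReal.ofReal (g z))) ⊗ₘ Q

lemma integral_comp_inv_smul_sub (k : Cov p → ℝ) (x : Cov p) {h : ℝ} (hh : 0 < h) :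
    ∫ z, k (h⁻¹ • (x - z)) = h ^ p * ∫ u, k u := by
  rw [integral_sub_left_eq_self (fun u => k (h⁻¹ • u)) volume x,
    Measure.integral_comp_inv_smul_of_nonneg volume k hh.le]
  simp

lemma integrable_comp_inv_smul_sub (hk : Integrable k) (x : Cov p) {h : ℝ} (hh : 0 < h) :
    Integrable fun z => k (h⁻¹ • (x - z)) :=
  ((integrable_comp_smul_iff volume k (inv_ne_zero hh.ne')).2 hk).comp_sub_left x

/-- The support of the kernel lies in the closed ball while the oscillation only controls the open
one; the sphere between them is a null set. -/
lemma ae_mem_ball_or_eq_zero (hks : Function.support k ⊆ Metric.closedBall 0 1) (x : Cov p)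
    {h : ℝ} (hh : 0 < h) :
    ∀ᵐ z, z ∈ Metric.ball x h ∨ k (h⁻¹ • (x - z)) = 0 := by
  have hs : ∀ᵐ z : Cov p, z ∉ Metric.sphere x h := by
    rw [ae_iff]
    have : {z | ¬ z ∉ Metric.sphere x h} = Metric.sphere x h := by ext; simp
    rw [this]
    exact Measure.addHaar_sphere_of_ne_zero volume x hh.ne'
  filter_upwards [hs] with z hz
  by_contra! hcon
  have h1 := hks (Function.mem_support.2 hcon.2)
  rw [mem_closedBall_zero_iff, norm_smul, norm_inv, Real.norm_of_nonneg hh.le,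
    inv_mul_le_iff₀ hh, mul_one, ← dist_eq_norm, dist_comm] at h1
  have h2 := hcon.1
  rw [Metric.mem_ball, not_lt] at h2
  exact hz (Metric.mem_sphere.2 (le_antisymm h1 h2))

lemma integral_pairLaw [IsFiniteMeasure (pairLaw g Q)] (hg : Measurable g) (hg0 : ∀ z, 0 ≤ g z)
    (hk : Measurable k) {M : ℝ} (hkM : ∀ u, |k u| ≤ M) {A : Set ℝ} (hA : MeasurableSet A) (h : ℝ) :
    ∫ e, k (h⁻¹ • (x - e.1)) * A.indicator 1 e.2 ∂(pairLaw g Q) =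
      ∫ z, g z * (k (h⁻¹ • (x - z)) * (Q z).real A) := by
  have hi : Measurable fun y : ℝ => A.indicator (1 : ℝ → ℝ) y := measurable_one.indicator hA
  have hm : Measurable fun e : Cov p × ℝ => k (h⁻¹ • (x - e.1)) * A.indicator 1 e.2 :=
    (hk.comp (by fun_prop)).mul (hi.comp measurable_snd)
  have hint : Integrable (fun e : Cov p × ℝ => k (h⁻¹ • (x - e.1)) * A.indicator 1 e.2)
      (pairLaw g Q) := by
    refine Integrable.of_bound hm.aestronglyMeasurable M (ae_of_all _ fun e => ?_)
    have hM : 0 ≤ M := (abs_nonneg _).trans (hkM 0)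
    by_cases he : e.2 ∈ A <;> simp [he, hkM, hM]
  rw [pairLaw] at hint ⊢
  rw [Measure.integral_compProd hint, integral_withDensity_eq_integral_toReal_smul
    hg.ennreal_ofReal (ae_of_all _ fun _ => ENNReal.ofReal_lt_top)]
  refine integral_congr_ae (ae_of_all _ fun z => ?_)
  simp only [smul_eq_mul, ENNReal.toReal_ofReal (hg0 z), integral_const_mul]
  rw [integral_indicator_one hA]

/-- Kernel averages of a function that is within `ε` of `b` on the bandwidth ball. -/
lemma abs_integral_pairLaw_sub_le [IsFiniteMeasure (pairLaw g Q)] (hg : Measurable g)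
    (hg0 : ∀ z, 0 ≤ g z) (hk : Measurable k) (hk0 : ∀ u, 0 ≤ k u) {M : ℝ} (hkM : ∀ u, k u ≤ M)
    (hki : Integrable k) (hks : Function.support k ⊆ Metric.closedBall 0 1)
    {A : Set ℝ} (hA : MeasurableSet A) {h : ℝ} (hh : 0 < h) {b ε : ℝ}
    (hb : ∀ z ∈ Metric.ball x h, |g z * (Q z).real A - b| ≤ ε) :
    |∫ e, k (h⁻¹ • (x - e.1)) * A.indicator 1 e.2 ∂(pairLaw g Q) - h ^ p * (b * ∫ u, k u)| ≤
      h ^ p * (ε * ∫ u, k u) := by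
  have hi := integrable_comp_inv_smul_sub hki x hh
  have hae := ae_mem_ball_or_eq_zero hks x hh
  have hQ : Measurable fun z => (Q z).real A := (Q.measurable_coe hA).ennreal_toReal
  have hdiff : ∀ᵐ z, ‖g z * (k (h⁻¹ • (x - z)) * (Q z).real A) - k (h⁻¹ • (x - z)) * b‖ ≤
      k (h⁻¹ • (x - z)) * ε := by
    filter_upwards [hae] with z hz
    rcases hz with hz | hz
    · have e : g z * (k (h⁻¹ • (x - z)) * (Q z).real A) - k (h⁻¹ • (x - z)) * b =
        k (h⁻¹ • (x - z)) * (g z * (Q z).real A - b) := by ring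
      rw [e, norm_mul, Real.norm_of_nonneg (hk0 _)]
      exact mul_le_mul_of_nonneg_left (hb z hz) (hk0 _)
    · simp [hz]
  have hmeas : Measurable fun z => k (h⁻¹ • (x - z)) := hk.comp (by fun_prop)
  have hmeasG : Measurable fun z => g z * (k (h⁻¹ • (x - z)) * (Q z).real A) :=
    hg.mul (hmeas.mul hQ)
  -- Integrability of the `g`-weighted integrand comes from its being close to the integrable
  -- function `k (h⁻¹ • (x - z)) * b`.
  have hd : Integrable fun z =>
      g z * (k (h⁻¹ • (x - z)) * (Q z).real A) - k (h⁻¹ • (x - z)) * b :=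
    (hi.mul_const ε).mono' (hmeasG.sub (hmeas.mul_const b)).aestronglyMeasurable hdiff
  have hG : Integrable fun z => g z * (k (h⁻¹ • (x - z)) * (Q z).real A) := by
    refine (hd.add (hi.mul_const b)).congr (ae_of_all _ fun z => ?_)
    simp
  rw [integral_pairLaw hg hg0 hk (fun u => by rw [abs_of_nonneg (hk0 u)]; exact hkM u) hA,
    show h ^ p * (b * ∫ u, k u) = ∫ z, k (h⁻¹ • (x - z)) * b by
      rw [integral_mul_const, integral_comp_inv_smul_sub k x hh]; ring,
    show h ^ p * (ε * ∫ u, k u) = ∫ z, k (h⁻¹ • (x - z)) * ε by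
      rw [integral_mul_const, integral_comp_inv_smul_sub k x hh]; ring,
    ← integral_sub hG (hi.mul_const b)]
  exact norm_integral_le_of_norm_le (hi.mul_const ε) hdiff

/-- Turns the oscillation into a pointwise bound. Boundedness matters here, since the real supremum
of an unbounded set is `0` by default. -/
lemma abs_condSurvival_sub_le {κ l h α β : ℝ} (hκ : 0 < κ) (hα : 0 < α)
    (hβ : β ∈ Icc (κ * α) (l * α)) {z : Cov p} (hz : z ∈ Metric.ball x h) :
    |condSurvival Q z (condQuantile Q β x) - β| ≤ β * oscillation Q h κ l x α := by
  have hβ0 : 0 < β := (mul_pos hκ hα).trans_le hβ.1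
  have h1 : |condSurvival Q z (condQuantile Q β x) / β - 1| ≤ oscillation Q h κ l x α :=
    le_csSup (oscillation_bddAbove Q x hκ hα) ⟨(z, β), ⟨hz, hβ⟩, rfl⟩
  have e : condSurvival Q z (condQuantile Q β x) - β =
      β * (condSurvival Q z (condQuantile Q β x) / β - 1) := by field_simp
  rw [e, abs_mul, abs_of_pos hβ0]
  exact mul_le_mul_of_nonneg_left h1 hβ0.le

end Moments

/-- The standing assumptions on the model, the smoothing kernel, the bandwidths and the levels. -/
structure ExtremalRegime {p : ℕ} (Q : Kernel (Cov p) ℝ) (g K : Cov p → ℝ) (γ L κ l : ℝ)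
    (x : Cov p) (h α : ℕ → ℝ) : Prop where
  vonMises : VonMises (condSurvival Q x) γ
  measurable_g : Measurable g
  g_nonneg : ∀ z, 0 ≤ g z
  lipschitz_nonneg : 0 ≤ L
  lipschitz : ∀ z z', |g z - g z'| ≤ L * dist z z'
  g_pos : 0 < g x
  kernel : IsSmoothingKernel K
  h_pos : ∀ n, 0 < h n
  α_pos : ∀ n, 0 < α n
  α_lt_one : ∀ n, α n < 1
  α_tendsto : Tendsto α atTop (𝓝 0)
  growth : Tendsto (fun n : ℕ => (n : ℝ) * h n ^ p * α n) atTop atTop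
  κ_pos : 0 < κ
  l_pos : 0 < l
  bias : Tendsto (fun n : ℕ => (n : ℝ) * h n ^ p * α n *
    (max (h n) (oscillation Q (h n) κ l x (α n))) ^ 2) atTop (𝓝 0)

/-! ### Moment expansions in the extremal regime. -/

namespace ExtremalRegime

variable {p : ℕ} {Q : Kernel (Cov p) ℝ} {g K k : Cov p → ℝ} {γ L κ l : ℝ}
  {x : Cov p} {h α : ℕ → ℝ}

lemma tendsto_sqrt_mul_bias (R : ExtremalRegime Q g K γ L κ l x h α) :
    Tendsto (fun n : ℕ => √((n : ℝ) * h n ^ p * α n) *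
      max (h n) (oscillation Q (h n) κ l x (α n))) atTop (𝓝 0) := by
  have := (Real.continuous_sqrt.tendsto _).comp R.bias
  rw [Real.sqrt_zero] at this
  refine this.congr fun n => ?_
  have h0 : 0 ≤ (n : ℝ) * h n ^ p * α n := by
    have := R.h_pos n; have := R.α_pos n; positivity
  simp only [Function.comp]
  rw [Real.sqrt_mul h0, Real.sqrt_sq ((R.h_pos n).le.trans (le_max_left _ _))]

lemma tendsto_bias (R : ExtremalRegime Q g K γ L κ l x h α) :
    Tendsto (fun n : ℕ => max (h n) (oscillation Q (h n) κ l x (α n))) atTop (𝓝 0) := by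
  refine squeeze_zero' (Eventually.of_forall fun n => (R.h_pos n).le.trans (le_max_left _ _)) ?_
    R.tendsto_sqrt_mul_bias
  filter_upwards [(Real.tendsto_sqrt_atTop.comp R.growth).eventually_ge_atTop 1] with n hn
  exact le_mul_of_one_le_left ((R.h_pos n).le.trans (le_max_left _ _)) hn

variable [IsMarkovKernel Q]

/-- First-order expansion of truncated kernel moments, with bias of smaller order than
`(n h^p α)^(-1/2)`. -/
lemma tendsto_moment (R : ExtremalRegime Q g K γ L κ l x h α) [IsFiniteMeasure (pairLaw g Q)]
    (hk : Measurable k) (hk0 : ∀ u, 0 ≤ k u) {M : ℝ} (hkM : ∀ u, k u ≤ M)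
    (hki : Integrable k) (hks : Function.support k ⊆ Metric.closedBall 0 1) {β : ℕ → ℝ}
    (hβ : ∀ᶠ n in atTop, β n ∈ Icc (κ * α n) (l * α n)) :
    Tendsto (fun n : ℕ => √((n : ℝ) * h n ^ p * α n) * ((h n ^ p * α n)⁻¹ *
      ∫ e, k ((h n)⁻¹ • (x - e.1)) * (Ioi (condQuantile Q (β n) x)).indicator 1 e.2 ∂(pairLaw g Q)
      - g x * (β n / α n) * ∫ u, k u)) atTop (𝓝 0) := by
  have hI : 0 ≤ ∫ u, k u := integral_nonneg hk0
  have hlim : Tendsto (fun n : ℕ => √((n : ℝ) * h n ^ p * α n) *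
      max (h n) (oscillation Q (h n) κ l x (α n)) * (l * (2 * L + g x) * ∫ u, k u))
      atTop (𝓝 0) := by
    simpa using R.tendsto_sqrt_mul_bias.mul_const (l * (2 * L + g x) * ∫ u, k u)
  refine squeeze_zero_norm' ?_ hlim
  filter_upwards [hβ, R.tendsto_bias.eventually (gt_mem_nhds zero_lt_one)] with n hβn hm
  set m := max (h n) (oscillation Q (h n) κ l x (α n)) with hmdef
  have hh := R.h_pos n
  have hα := R.α_pos n
  have hL := R.lipschitz_nonneg
  have hgx := R.g_pos
  have hβ0 : 0 < β n := (mul_pos R.κ_pos hα).trans_le hβn.1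
  have hm0 : 0 < m := hh.trans_le (le_max_left _ _)
  have hb : ∀ z ∈ Metric.ball x (h n),
      |g z * (Q z).real (Ioi (condQuantile Q (β n) x)) - g x * β n| ≤
        l * α n * (m * (2 * L + g x)) := by
    intro z hz
    set F := (Q z).real (Ioi (condQuantile Q (β n) x)) with hF
    have h1 : |F - β n| ≤ β n * m :=
      (abs_condSurvival_sub_le (Q := Q) R.κ_pos hα hβn hz).trans
        (mul_le_mul_of_nonneg_left (le_max_right _ _) hβ0.le)
    have h2 : |g z - g x| ≤ L * m := (R.lipschitz z x).trans
      (mul_le_mul_of_nonneg_left ((Metric.mem_ball.1 hz).le.trans (le_max_left _ _)) hL)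
    have hF0 : 0 ≤ F := measureReal_nonneg
    -- Uses `m < 1`. It keeps the error from the Lipschitz bound on `g` proportional to the level `β
    -- n`, not merely bounded.
    have hF2 : F ≤ 2 * β n := by
      have := (abs_le.1 h1).2
      nlinarith
    have e : g z * F - g x * β n = (g z - g x) * F + g x * (F - β n) := by ring
    calc |g z * F - g x * β n| ≤ |g z - g x| * F + g x * |F - β n| := by
          rw [e]
          refine (abs_add_le _ _).trans ?_
          rw [abs_mul, abs_mul, abs_of_nonneg hF0, abs_of_pos hgx]
      _ ≤ (L * m) * (2 * β n) + g x * (β n * m) := by gcongr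
      _ = β n * (m * (2 * L + g x)) := by ring
      _ ≤ l * α n * (m * (2 * L + g x)) := by
          have := hβn.2
          gcongr
  have hest := abs_integral_pairLaw_sub_le (Q := Q) (x := x) R.measurable_g R.g_nonneg hk hk0 hkM
    hki hks (measurableSet_Ioi (a := condQuantile Q (β n) x)) hh hb
  set T := ∫ e, k ((h n)⁻¹ • (x - e.1)) *
    (Ioi (condQuantile Q (β n) x)).indicator 1 e.2 ∂(pairLaw g Q) with hT
  have hp : 0 < h n ^ p * α n := by positivity
  have e : (h n ^ p * α n)⁻¹ * T - g x * (β n / α n) * ∫ u, k u =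
      (h n ^ p * α n)⁻¹ * (T - h n ^ p * (g x * β n * ∫ u, k u)) := by
    field_simp
  rw [Real.norm_eq_abs, abs_mul, abs_of_nonneg (Real.sqrt_nonneg _),
    mul_assoc (√((n : ℝ) * h n ^ p * α n)) m, e, abs_mul,
    abs_of_pos (inv_pos.2 hp)]
  refine mul_le_mul_of_nonneg_left ?_ (Real.sqrt_nonneg _)
  calc (h n ^ p * α n)⁻¹ * |T - h n ^ p * (g x * β n * ∫ u, k u)|
      ≤ (h n ^ p * α n)⁻¹ * (h n ^ p * (l * α n * (m * (2 * L + g x)) * ∫ u, k u)) := by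
        gcongr
    _ = m * (l * (2 * L + g x) * ∫ u, k u) := by field_simp

/-- First-order expansion of kernel moments of the covariate. -/
lemma tendsto_moment_univ (R : ExtremalRegime Q g K γ L κ l x h α)
    [IsFiniteMeasure (pairLaw g Q)]
    (hk : Measurable k) (hk0 : ∀ u, 0 ≤ k u) {M : ℝ} (hkM : ∀ u, k u ≤ M)
    (hki : Integrable k) (hks : Function.support k ⊆ Metric.closedBall 0 1) :
    Tendsto (fun n : ℕ => √((n : ℝ) * h n ^ p * α n) * ((h n ^ p)⁻¹ *
      ∫ e, k ((h n)⁻¹ • (x - e.1)) ∂(pairLaw g Q) - g x * ∫ u, k u)) atTop (𝓝 0) := by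
  have hI : 0 ≤ ∫ u, k u := integral_nonneg hk0
  have hlim : Tendsto (fun n : ℕ => √((n : ℝ) * h n ^ p * α n) *
      max (h n) (oscillation Q (h n) κ l x (α n)) * (L * ∫ u, k u)) atTop (𝓝 0) := by
    simpa using R.tendsto_sqrt_mul_bias.mul_const (L * ∫ u, k u)
  refine squeeze_zero_norm (fun n => ?_) hlim
  set m := max (h n) (oscillation Q (h n) κ l x (α n)) with hmdef
  have hh := R.h_pos n
  have hL := R.lipschitz_nonneg
  have hb : ∀ z ∈ Metric.ball x (h n), |g z * (Q z).real univ - g x| ≤ L * m := by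
    intro z hz
    rw [probReal_univ, mul_one]
    exact (R.lipschitz z x).trans
      (mul_le_mul_of_nonneg_left ((Metric.mem_ball.1 hz).le.trans (le_max_left _ _)) hL)
  have hest := abs_integral_pairLaw_sub_le (Q := Q) (x := x) R.measurable_g R.g_nonneg hk hk0 hkM
    hki hks MeasurableSet.univ hh hb
  simp only [indicator_univ, Pi.one_apply, mul_one] at hest
  have e : (h n ^ p)⁻¹ * ∫ e, k ((h n)⁻¹ • (x - e.1)) ∂(pairLaw g Q) - g x * ∫ u, k u =
      (h n ^ p)⁻¹ * (∫ e, k ((h n)⁻¹ • (x - e.1)) ∂(pairLaw g Q)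
        - h n ^ p * (g x * ∫ u, k u)) := by
    field_simp
  have hp : 0 < h n ^ p := by positivity
  rw [Real.norm_eq_abs, abs_mul, abs_of_nonneg (Real.sqrt_nonneg _),
    mul_assoc (√((n : ℝ) * h n ^ p * α n)) m, e, abs_mul,
    abs_of_pos (inv_pos.2 hp)]
  refine mul_le_mul_of_nonneg_left ?_ (Real.sqrt_nonneg _)
  rw [inv_mul_le_iff₀ hp]
  refine hest.trans (le_of_eq ?_)
  ring

end ExtremalRegime

/-! ### Inversion and measurability of the kernel quantile. -/

lemma upperQuantile_le_iff {S : ℝ → ℝ} (hS : Antitone S)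
    (hrc : ∀ t, ContinuousWithinAt S (Ioi t) t) {β : ℝ} (hne : {t | S t ≤ β}.Nonempty)
    (hbd : BddBelow {t | S t ≤ β}) (y : ℝ) : upperQuantile S β ≤ y ↔ S y ≤ β := by
  refine ⟨fun h => ?_, fun h => csInf_le hbd h⟩
  have hgt : ∀ t, y < t → S t ≤ β := fun t ht => by
    obtain ⟨s, hs, hst⟩ := exists_lt_of_csInf_lt hne (lt_of_le_of_lt h ht)
    exact (hS hst.le).trans hs
  -- Right-continuity carries the inequality from all points beyond `y` to `y` itself, so the
  -- infimum belongs to the sublevel set.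
  refine le_of_tendsto (hrc y) ?_
  filter_upwards [self_mem_nhdsWithin] with t ht using hgt t ht

lemma antitone_indicator_Ioi (a : ℝ) : Antitone fun y => (Ioi y).indicator (1 : ℝ → ℝ) a := by
  intro s t hst
  by_cases h : t < a
  · simp [h, hst.trans_lt h]
  · simp only [indicator, mem_Ioi, h, if_false]
    split_ifs <;> simp

lemma continuousWithinAt_indicator_Ioi (a t : ℝ) :
    ContinuousWithinAt (fun y => (Ioi y).indicator (1 : ℝ → ℝ) a) (Ioi t) t := by
  by_cases h : t < a
  · refine ContinuousAt.continuousWithinAt ?_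
    refine (continuousAt_const (y := (1 : ℝ))).congr ?_
    filter_upwards [gt_mem_nhds h] with y hy
    simp [hy]
  · refine (continuousWithinAt_const (b := (0 : ℝ))).congr (fun y hy => ?_) (by simp [h])
    have : ¬ y < a := fun h' => h (lt_trans hy h')
    simp [this]

section Inversion

variable {p : ℕ} {K : Cov p → ℝ} {h : ℝ} {n : ℕ} {x : Cov p}

lemma kernelSurvival_eq (hh : 0 < h) (X : ℕ → Cov p) (Y : ℕ → ℝ) (y : ℝ) :
    kernelSurvival K h n X Y x y =
      (∑ i ∈ Finset.range n, K (h⁻¹ • (x - X i)) * (Ioi y).indicator 1 (Y i)) /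
        ∑ i ∈ Finset.range n, K (h⁻¹ • (x - X i)) := by
  have hp : (h ^ p) ≠ 0 := (pow_pos hh p).ne'
  simp only [kernelSurvival, rescaled, div_mul_eq_mul_div, ← Finset.sum_div]
  exact div_div_div_cancel_right₀ hp _ _

/-- With nonzero total weight the estimator is `1` below all observations and `0` beyond them, so
the sublevel set is nonempty and bounded below for levels in `(0, 1)`. -/
lemma kernelQuantile_le_iff_kernelSurvival_le (hK : ∀ u, 0 ≤ K u) (hh : 0 < h) {X : ℕ → Cov p}
    {Y : ℕ → ℝ} (hw : ∑ i ∈ Finset.range n, K (h⁻¹ • (x - X i)) ≠ 0) {β : ℝ}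
    (hβ0 : 0 < β) (hβ1 : β < 1) (y : ℝ) :
    kernelQuantile K h n X Y β x ≤ y ↔ kernelSurvival K h n X Y x y ≤ β := by
  have hw0 : 0 ≤ ∑ i ∈ Finset.range n, K (h⁻¹ • (x - X i)) := Finset.sum_nonneg fun i _ => hK _
  have hfun : kernelSurvival K h n X Y x = fun y =>
      (∑ i ∈ Finset.range n, K (h⁻¹ • (x - X i)) * (Ioi y).indicator 1 (Y i)) /
        ∑ i ∈ Finset.range n, K (h⁻¹ • (x - X i)) :=
    funext fun y => kernelSurvival_eq hh X Y y
  obtain ⟨b, hb⟩ := ((Finset.range n).image Y).bddAbove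
  obtain ⟨a, ha⟩ := ((Finset.range n).image Y).bddBelow
  refine upperQuantile_le_iff ?_ ?_ ⟨b, ?_⟩ ⟨a, ?_⟩ y
  · rw [hfun]
    intro s t hst
    exact div_le_div_of_nonneg_right (Finset.sum_le_sum fun i _ =>
      mul_le_mul_of_nonneg_left (antitone_indicator_Ioi (Y i) hst) (hK _)) hw0
  · intro t
    rw [hfun]
    have h1 : ContinuousWithinAt (fun y => ∑ i ∈ Finset.range n, K (h⁻¹ • (x - X i)) *
        (Ioi y).indicator (1 : ℝ → ℝ) (Y i)) (Ioi t) t :=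
      tendsto_finsetSum _ fun i _ => (continuousWithinAt_indicator_Ioi (Y i) t).const_mul _
    exact h1.div_const _
  · have : kernelSurvival K h n X Y x b = 0 := by
      rw [kernelSurvival_eq hh, Finset.sum_eq_zero, zero_div]
      intro i hi
      have : ¬ b < Y i := not_lt.2 (hb (Finset.mem_coe.2 (Finset.mem_image_of_mem Y hi)))
      simp [this]
    show kernelSurvival K h n X Y x b ≤ β
    rw [this]
    exact hβ0.le
  · intro t ht
    by_contra hlt
    have ht' : kernelSurvival K h n X Y x t ≤ β := ht
    have : kernelSurvival K h n X Y x t = 1 := by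
      rw [kernelSurvival_eq hh, Finset.sum_congr rfl (g := fun i => K (h⁻¹ • (x - X i))),
        div_self hw]
      intro i hi
      have : t < Y i := (not_le.1 hlt).trans_le
        (ha (Finset.mem_coe.2 (Finset.mem_image_of_mem Y hi)))
      simp [this]
    linarith

/-- The kernel quantile lies left of `y` iff the centred kernel sum at `y` is nonpositive. -/
lemma kernelQuantile_le_iff (hK : ∀ u, 0 ≤ K u) (hh : 0 < h) {X : ℕ → Cov p}
    {Y : ℕ → ℝ} (hw : ∑ i ∈ Finset.range n, K (h⁻¹ • (x - X i)) ≠ 0) {β : ℝ}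
    (hβ0 : 0 < β) (hβ1 : β < 1) (y : ℝ) :
    kernelQuantile K h n X Y β x ≤ y ↔
      ∑ i ∈ Finset.range n, K (h⁻¹ • (x - X i)) * ((Ioi y).indicator 1 (Y i) - β) ≤ 0 := by
  have hw0 : 0 < ∑ i ∈ Finset.range n, K (h⁻¹ • (x - X i)) :=
    lt_of_le_of_ne (Finset.sum_nonneg fun i _ => hK _) hw.symm
  rw [kernelQuantile_le_iff_kernelSurvival_le hK hh hw hβ0 hβ1, kernelSurvival_eq hh,
    div_le_iff₀ hw0, Finset.mul_sum, ← sub_nonpos, ← Finset.sum_sub_distrib]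
  simp only [mul_sub, mul_comm β]

lemma measurable_kernelQuantile {Ω : Type*} [MeasurableSpace Ω] (hKm : Measurable K)
    (hK : ∀ u, 0 ≤ K u) (hh : 0 < h) {X : ℕ → Ω → Cov p} {Y : ℕ → Ω → ℝ}
    (hX : ∀ i, Measurable (X i)) (hY : ∀ i, Measurable (Y i)) {β : ℝ} (hβ0 : 0 < β) (hβ1 : β < 1) :
    Measurable fun ω => kernelQuantile K h n (fun i => X i ω) (fun i => Y i ω) β x := by
  have hw : ∀ i, Measurable fun ω => K (h⁻¹ • (x - X i ω)) := fun i => by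
    have hXi := hX i
    exact hKm.comp (by fun_prop : Measurable fun ω => h⁻¹ • (x - X i ω))
  have hsum : Measurable fun ω => ∑ i ∈ Finset.range n, K (h⁻¹ • (x - X i ω)) :=
    Finset.measurable_fun_sum _ fun i _ => hw i
  refine measurable_of_Iic fun y => ?_
  have hS : Measurable fun ω => kernelSurvival K h n (fun i => X i ω) (fun i => Y i ω) x y := by
    simp only [fun ω => kernelSurvival_eq (K := K) (n := n) (x := x) hh (fun i => X i ω)
      (fun i => Y i ω) y]
    refine Measurable.div (Finset.measurable_fun_sum _ fun i _ => (hw i).mul ?_) hsum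
    have hi : Measurable fun a : ℝ => (Ioi y).indicator (1 : ℝ → ℝ) a :=
      measurable_one.indicator measurableSet_Ioi
    exact hi.comp (hY i)
  have h0 : MeasurableSet {ω | ∑ i ∈ Finset.range n, K (h⁻¹ • (x - X i ω)) = 0} :=
    hsum (measurableSet_singleton 0)
  -- If all weights vanish, the quotient `0 / 0` is `0`, the sublevel set is all of `ℝ`, and its
  -- `sInf` is `0` by default; that event contributes exactly when `0 ≤ y`.
  have hset : (fun ω => kernelQuantile K h n (fun i => X i ω) (fun i => Y i ω) β x) ⁻¹' Iic y =
      ({ω | ∑ i ∈ Finset.range n, K (h⁻¹ • (x - X i ω)) = 0} ∩ {_ω | 0 ≤ y}) ∪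
      ({ω | ∑ i ∈ Finset.range n, K (h⁻¹ • (x - X i ω)) = 0}ᶜ ∩
        {ω | kernelSurvival K h n (fun i => X i ω) (fun i => Y i ω) x y ≤ β}) := by
    ext ω
    by_cases hω : ∑ i ∈ Finset.range n, K (h⁻¹ • (x - X i ω)) = 0
    · have hq : kernelQuantile K h n (fun i => X i ω) (fun i => Y i ω) β x = 0 := by
        rw [kernelQuantile, upperQuantile]
        have : {t | kernelSurvival K h n (fun i => X i ω) (fun i => Y i ω) x t ≤ β} = univ := by
          refine eq_univ_of_forall fun t => ?_
          show kernelSurvival K h n (fun i => X i ω) (fun i => Y i ω) x t ≤ β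
          rw [kernelSurvival_eq hh, hω, div_zero]
          exact hβ0.le
        rw [this, Real.sInf_univ]
      simp [hω, hq]
    · simp only [mem_preimage, mem_Iic, mem_union, mem_inter_iff, mem_ofPred_eq, hω, false_and,
        mem_compl_iff, not_false_eq_true, true_and, false_or]
      exact kernelQuantile_le_iff_kernelSurvival_le hK hh hω hβ0 hβ1 y
  rw [hset]
  exact (h0.inter (MeasurableSet.const _)).union
    (h0.compl.inter (measurableSet_le hS measurable_const))

end Inversion

lemma condSurvival_antitone {p : ℕ} (Q : Kernel (Cov p) ℝ) [IsMarkovKernel Q] (x : Cov p) :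
    Antitone (condSurvival Q x) := fun _ _ hst => measureReal_mono (Ioi_subset_Ioi hst)

/-- If the survival function vanished everywhere, the half-lines `(-m, ∞)` would be null and exhaust
`ℝ`, contradicting total mass one. -/
lemma bot_lt_rightEndpoint_condSurvival {p : ℕ} (Q : Kernel (Cov p) ℝ) [IsMarkovKernel Q]
    (x : Cov p) : ⊥ < rightEndpoint (condSurvival Q x) := by
  by_cases hex : ∃ t, 0 < condSurvival Q x t
  · obtain ⟨t, ht⟩ := hex
    exact bot_lt_rightEndpoint (condSurvival_antitone Q x) ht
  · exfalso
    push Not at hex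
    have h0 : ∀ m : ℕ, Q x (Ioi (-(m : ℝ))) = 0 := fun m => by
      have := le_antisymm (hex (-(m : ℝ))) measureReal_nonneg
      exact (measureReal_eq_zero_iff (measure_ne_top _ _)).1 this
    have hU : (⋃ m : ℕ, Ioi (-(m : ℝ))) = univ := by
      refine eq_univ_of_forall fun t => mem_iUnion.2 ?_
      obtain ⟨m, hm⟩ := exists_nat_gt (-t)
      exact ⟨m, by rw [mem_Ioi]; linarith⟩
    have := measure_iUnion_null h0
    rw [hU, measure_univ] at this
    exact one_ne_zero this

/-- A centred and normalized term of the kernel sum at the conditional quantile of level `β`. -/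
noncomputable def kernelTerm {p : ℕ} (Q : Kernel (Cov p) ℝ) (K : Cov p → ℝ) (x : Cov p)
    (h r β b : ℝ) (e : Cov p × ℝ) : ℝ :=
  K (h⁻¹ • (x - e.1)) * ((Ioi (condQuantile Q β x)).indicator 1 e.2 - b) / r

lemma measurable_kernelTerm {p : ℕ} (Q : Kernel (Cov p) ℝ) {K : Cov p → ℝ} (hK : Measurable K)
    (x : Cov p) (h r β b : ℝ) : Measurable (kernelTerm Q K x h r β b) := by
  have h1 : Measurable fun e : Cov p × ℝ => K (h⁻¹ • (x - e.1)) := hK.comp (by fun_prop)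
  have h2 : Measurable fun e : Cov p × ℝ =>
      (Ioi (condQuantile Q β x)).indicator (1 : ℝ → ℝ) e.2 :=
    (measurable_one.indicator measurableSet_Ioi).comp measurable_snd
  exact (h1.mul (h2.sub_const b)).div_const r

lemma abs_kernelTerm_le {p : ℕ} (Q : Kernel (Cov p) ℝ) {K : Cov p → ℝ} (hK0 : ∀ u, 0 ≤ K u)
    {M : ℝ} (hM : ∀ u, K u ≤ M) (x : Cov p) (h β : ℝ) {r b : ℝ} (hr : 0 ≤ r) (hb : b ∈ Icc 0 1)
    (e : Cov p × ℝ) : |kernelTerm Q K x h r β b e| ≤ M / r := by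
  rw [kernelTerm, abs_div, abs_of_nonneg hr, abs_mul, abs_of_nonneg (hK0 _)]
  refine div_le_div_of_nonneg_right ?_ hr
  have h1 : |(Ioi (condQuantile Q β x)).indicator (1 : ℝ → ℝ) e.2 - b| ≤ 1 := by
    by_cases he : e.2 ∈ Ioi (condQuantile Q β x)
    · rw [indicator_of_mem he, Pi.one_apply, abs_le]
      constructor <;> linarith [hb.1, hb.2]
    · rw [indicator_of_notMem he, abs_le]
      constructor <;> linarith [hb.1, hb.2]
  calc _ ≤ K (h⁻¹ • (x - e.1)) * 1 := mul_le_mul_of_nonneg_left h1 (hK0 _)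
    _ ≤ M := by rw [mul_one]; exact hM _

lemma integrable_kernel {p : ℕ} {μ : Measure (Cov p × ℝ)} [IsFiniteMeasure μ] {k : Cov p → ℝ}
    (hk : Measurable k) (hk0 : ∀ u, 0 ≤ k u) {M : ℝ} (hkM : ∀ u, k u ≤ M) (x : Cov p) (h : ℝ) :
    Integrable (fun e => k (h⁻¹ • (x - e.1))) μ :=
  Integrable.of_bound (hk.comp (by fun_prop)).aestronglyMeasurable M
    (ae_of_all _ fun e => by rw [Real.norm_of_nonneg (hk0 _)]; exact hkM _)

lemma integrable_kernel_indicator {p : ℕ} {μ : Measure (Cov p × ℝ)} [IsFiniteMeasure μ]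
    {k : Cov p → ℝ} (hk : Measurable k) (hk0 : ∀ u, 0 ≤ k u) {M : ℝ} (hkM : ∀ u, k u ≤ M)
    (x : Cov p) (h y : ℝ) :
    Integrable (fun e => k (h⁻¹ • (x - e.1)) * (Ioi y).indicator 1 e.2) μ := by
  have h2 : Measurable fun e : Cov p × ℝ => (Ioi y).indicator (1 : ℝ → ℝ) e.2 :=
    (measurable_one.indicator measurableSet_Ioi).comp measurable_snd
  refine (integrable_kernel hk hk0 hkM x h).mono'
    ((hk.comp (by fun_prop)).mul h2).aestronglyMeasurable (ae_of_all _ fun e => ?_)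
  rw [norm_mul, Real.norm_of_nonneg (hk0 _)]
  refine mul_le_of_le_one_right (hk0 _) ?_
  by_cases he : e.2 ∈ Ioi y <;> simp [he, -mem_Ioi]

lemma integral_sub_sub_add {E : Type*} [MeasurableSpace E] {μ : Measure E} {f₁ f₂ f₃ f₄ : E → ℝ}
    (h₁ : Integrable f₁ μ) (h₂ : Integrable f₂ μ) (h₃ : Integrable f₃ μ) (h₄ : Integrable f₄ μ)
    (a b c : ℝ) :
    ∫ e, (f₁ e - a * f₂ e - b * f₃ e + c * f₄ e) ∂μ =
      ∫ e, f₁ e ∂μ - a * ∫ e, f₂ e ∂μ - b * ∫ e, f₃ e ∂μ + c * ∫ e, f₄ e ∂μ := by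
  rw [integral_add (f := fun e => f₁ e - a * f₂ e - b * f₃ e) (g := fun e => c * f₄ e)
      ((h₁.sub (h₂.const_mul a)).sub (h₃.const_mul b)) (h₄.const_mul c),
    integral_sub (f := fun e => f₁ e - a * f₂ e) (g := fun e => b * f₃ e)
      (h₁.sub (h₂.const_mul a)) (h₃.const_mul b),
    integral_sub h₁ (h₂.const_mul a), integral_const_mul, integral_const_mul, integral_const_mul]

/-! ### Moments of the centred kernel sums. -/

namespace ExtremalRegime

variable {p : ℕ} {Q : Kernel (Cov p) ℝ} {g K k : Cov p → ℝ} {γ L κ l : ℝ}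
  {x : Cov p} {h α : ℕ → ℝ}

lemma sqrt_tendsto (R : ExtremalRegime Q g K γ L κ l x h α) :
    Tendsto (fun n : ℕ => √((n : ℝ) * h n ^ p * α n)) atTop atTop :=
  Real.tendsto_sqrt_atTop.comp R.growth

lemma eventually_sqrt_pos (R : ExtremalRegime Q g K γ L κ l x h α) :
    ∀ᶠ n : ℕ in atTop, 0 < √((n : ℝ) * h n ^ p * α n) :=
  R.sqrt_tendsto.eventually_gt_atTop 0

lemma sq_sqrt (R : ExtremalRegime Q g K γ L κ l x h α) (n : ℕ) :
    √((n : ℝ) * h n ^ p * α n) ^ 2 = n * h n ^ p * α n := by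
  have := R.h_pos n
  have := R.α_pos n
  exact Real.sq_sqrt (by positivity)

lemma tendsto_of_sqrt_mul (R : ExtremalRegime Q g K γ L κ l x h α) {u : ℕ → ℝ}
    (hu : Tendsto (fun n : ℕ => √((n : ℝ) * h n ^ p * α n) * u n) atTop (𝓝 0)) :
    Tendsto u atTop (𝓝 0) := by
  have := R.sqrt_tendsto.inv_tendsto_atTop.mul hu
  rw [mul_zero] at this
  refine this.congr' ?_
  filter_upwards [R.eventually_sqrt_pos] with n hn
  simp only [Pi.inv_apply]
  field_simp

lemma level_div_tendsto (R : ExtremalRegime Q g K γ L κ l x h α) (τ z : ℝ) :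
    Tendsto (fun n : ℕ => τ * α n * (1 - τ ^ γ * z / √((n : ℝ) * h n ^ p * α n)) / α n)
      atTop (𝓝 τ) := by
  have h1 : Tendsto (fun n : ℕ => 1 - τ ^ γ * z / √((n : ℝ) * h n ^ p * α n)) atTop (𝓝 1) := by
    simpa [div_eq_mul_inv] using (tendsto_const_nhds (x := (1 : ℝ))).sub
      ((tendsto_const_nhds (x := τ ^ γ * z)).mul R.sqrt_tendsto.inv_tendsto_atTop)
  have h2 := h1.const_mul τ
  rw [mul_one] at h2
  refine h2.congr fun n => ?_
  have := (R.α_pos n).ne'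
  field_simp

lemma eventually_mem_Icc (R : ExtremalRegime Q g K γ L κ l x h α) {β : ℕ → ℝ} {b : ℝ}
    (hβ : Tendsto (fun n => β n / α n) atTop (𝓝 b)) (hκ : κ < b) (hl : b < l) :
    ∀ᶠ n in atTop, β n ∈ Icc (κ * α n) (l * α n) := by
  filter_upwards [hβ.eventually (lt_mem_nhds hκ), hβ.eventually (gt_mem_nhds hl)] with n h1 h2
  exact ⟨((lt_div_iff₀ (R.α_pos n)).1 h1).le, ((div_lt_iff₀ (R.α_pos n)).1 h2).le⟩

lemma tendsto_level (R : ExtremalRegime Q g K γ L κ l x h α) {β : ℕ → ℝ}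
    (hβ : ∀ᶠ n in atTop, β n ∈ Icc (κ * α n) (l * α n)) : Tendsto β atTop (𝓝[>] 0) := by
  refine tendsto_nhdsWithin_iff.2 ⟨?_, ?_⟩
  · have h1 := R.α_tendsto.const_mul κ
    have h2 := R.α_tendsto.const_mul l
    rw [mul_zero] at h1 h2
    exact tendsto_of_tendsto_of_tendsto_of_le_of_le' h1 h2 (hβ.mono fun n hn => hn.1)
      (hβ.mono fun n hn => hn.2)
  · filter_upwards [hβ] with n hn
    exact (mul_pos R.κ_pos (R.α_pos n)).trans_le hn.1

variable [IsMarkovKernel Q]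

/-- Needed for products of exceedance indicators: exceeding both thresholds means exceeding the
larger, whose level is the smaller. The order reverses because the quantile is a right inverse of an
antitone function. -/
lemma eventually_max_condQuantile (R : ExtremalRegime Q g K γ L κ l x h α) {β β' : ℕ → ℝ}
    (hβ : ∀ᶠ n in atTop, β n ∈ Icc (κ * α n) (l * α n))
    (hβ' : ∀ᶠ n in atTop, β' n ∈ Icc (κ * α n) (l * α n)) :
    ∀ᶠ n in atTop, max (condQuantile Q (β n) x) (condQuantile Q (β' n) x) =
      condQuantile Q (min (β n) (β' n)) x := by
  have hS := condSurvival_antitone Q x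
  have hinv := R.vonMises.eventually_apply_upperQuantile hS
    (bot_lt_rightEndpoint_condSurvival Q x)
  have key : ∀ a b : ℝ, condSurvival Q x (condQuantile Q a x) = a →
      condSurvival Q x (condQuantile Q b x) = b → a ≤ b →
      condQuantile Q b x ≤ condQuantile Q a x := by
    intro a b ha hb hab
    by_contra! hlt
    have h1 := hS hlt.le
    rw [ha, hb] at h1
    rw [le_antisymm hab h1] at hlt
    exact lt_irrefl _ hlt
  filter_upwards [(R.tendsto_level hβ).eventually hinv, (R.tendsto_level hβ').eventually hinv]
    with n h1 h2
  rcases le_total (β n) (β' n) with hle | hle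
  · rw [min_eq_left hle, max_eq_left (key _ _ h1 h2 hle)]
  · rw [min_eq_right hle, max_eq_right (key _ _ h2 h1 hle)]

variable [IsFiniteMeasure (pairLaw g Q)]

/-- Means of the centred kernel sums. -/
lemma tendsto_mean (R : ExtremalRegime Q g K γ L κ l x h α) {τ : ℝ} (hτ : 0 < τ) (hκ : κ < τ)
    (hl : τ < l) (z : ℝ) :
    Tendsto (fun n : ℕ => n * ∫ e, kernelTerm Q K x (h n) (√((n : ℝ) * h n ^ p * α n))
      (τ * α n * (1 - τ ^ γ * z / √((n : ℝ) * h n ^ p * α n))) (τ * α n) e ∂(pairLaw g Q))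
      atTop (𝓝 (-(g x * τ ^ (γ + 1) * z))) := by
  obtain ⟨M, hM⟩ := R.kernel.bounded
  have hβ := R.eventually_mem_Icc (R.level_div_tendsto τ z) hκ hl
  have t1 := R.tendsto_moment R.kernel.measurable R.kernel.nonneg hM R.kernel.integrable
    R.kernel.support_subset hβ
  have t2 := R.tendsto_moment_univ R.kernel.measurable R.kernel.nonneg hM R.kernel.integrable
    R.kernel.support_subset
  -- Both biases vanish even after multiplication by `r`; what remains is the exact identity `r (β/α
  -- - τ) = -τ^(γ+1) z`.
  have t := (t1.sub (t2.const_mul τ)).sub_const (g x * τ ^ (γ + 1) * z)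
  rw [mul_zero, sub_zero, zero_sub] at t
  refine t.congr' ?_
  filter_upwards [R.eventually_sqrt_pos] with n hn
  have hsq := R.sq_sqrt n
  set r := √((n : ℝ) * h n ^ p * α n) with hr
  have hh : h n ^ p ≠ 0 := (pow_pos (R.h_pos n) p).ne'
  have hα := (R.α_pos n).ne'
  have hint : ∫ e, kernelTerm Q K x (h n) r (τ * α n * (1 - τ ^ γ * z / r)) (τ * α n) e
      ∂(pairLaw g Q) =
      (∫ e, K ((h n)⁻¹ • (x - e.1)) * (Ioi (condQuantile Q
        (τ * α n * (1 - τ ^ γ * z / r)) x)).indicator 1 e.2 ∂(pairLaw g Q) -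
        (τ * α n) * ∫ e, K ((h n)⁻¹ • (x - e.1)) ∂(pairLaw g Q)) / r := by
    rw [← integral_const_mul, ← integral_sub
      (integrable_kernel_indicator R.kernel.measurable R.kernel.nonneg hM x _ _)
      ((integrable_kernel R.kernel.measurable R.kernel.nonneg hM x _).const_mul _),
      ← integral_div]
    refine integral_congr_ae (ae_of_all _ fun e => ?_)
    simp only [kernelTerm]
    ring
  rw [hint, R.kernel.integral_eq_one]
  generalize ∫ e, K ((h n)⁻¹ • (x - e.1)) * (Ioi (condQuantile Q
        (τ * α n * (1 - τ ^ γ * z / r)) x)).indicator 1 e.2 ∂(pairLaw g Q) = I1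
  generalize ∫ e, K ((h n)⁻¹ • (x - e.1)) ∂(pairLaw g Q) = I0
  rw [Real.rpow_add hτ, Real.rpow_one]
  have hnr : (n : ℝ) = r ^ 2 / (h n ^ p * α n) := by rw [hsq]; field_simp
  rw [hnr]
  field_simp
  ring

/-- Second moments of the centred kernel sums. -/
lemma tendsto_second_moment (R : ExtremalRegime Q g K γ L κ l x h α) {β β' : ℕ → ℝ} {b b' : ℝ}
    (hβ : Tendsto (fun n => β n / α n) atTop (𝓝 b)) (hκ : κ < b) (hl : b < l)
    (hβ' : Tendsto (fun n => β' n / α n) atTop (𝓝 b')) (hκ' : κ < b') (hl' : b' < l)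
    (τ τ' : ℝ) :
    Tendsto (fun n : ℕ => n * ∫ e, kernelTerm Q K x (h n) (√((n : ℝ) * h n ^ p * α n))
        (β n) (τ * α n) e * kernelTerm Q K x (h n) (√((n : ℝ) * h n ^ p * α n))
        (β' n) (τ' * α n) e ∂(pairLaw g Q)) atTop
      (𝓝 (g x * min b b' * ∫ u, K u ^ 2)) := by
  obtain ⟨M, hM⟩ := R.kernel.bounded
  have hk : Measurable fun u => K u ^ 2 := R.kernel.measurable.pow_const 2
  have hk0 : ∀ u, 0 ≤ K u ^ 2 := fun u => sq_nonneg _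
  have hkM : ∀ u, K u ^ 2 ≤ M ^ 2 := fun u => pow_le_pow_left₀ (R.kernel.nonneg u) (hM u) 2
  have hki : Integrable fun u => K u ^ 2 := by
    refine (R.kernel.integrable.const_mul M).mono' hk.aestronglyMeasurable
      (ae_of_all _ fun u => ?_)
    rw [Real.norm_of_nonneg (hk0 u), pow_two]
    exact mul_le_mul_of_nonneg_right (hM u) (R.kernel.nonneg u)
  have hks : Function.support (fun u => K u ^ 2) ⊆ Metric.closedBall 0 1 := fun u hu =>
    R.kernel.support_subset (Function.mem_support.2 fun h0 => hu (by simp [h0]))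
  have moment : ∀ {δ : ℕ → ℝ} {d : ℝ}, Tendsto (fun n => δ n / α n) atTop (𝓝 d) →
      (∀ᶠ n in atTop, δ n ∈ Icc (κ * α n) (l * α n)) →
      Tendsto (fun n => (h n ^ p * α n)⁻¹ * ∫ e, K ((h n)⁻¹ • (x - e.1)) ^ 2 *
        (Ioi (condQuantile Q (δ n) x)).indicator 1 e.2 ∂(pairLaw g Q)) atTop
        (𝓝 (g x * d * ∫ u, K u ^ 2)) := by
    intro δ d hd hδ
    have h1 := R.tendsto_of_sqrt_mul (R.tendsto_moment hk hk0 hkM hki hks hδ)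
    have h2 := (hd.const_mul (g x)).mul_const (∫ u, K u ^ 2)
    simpa using h1.add h2
  have m0 : Tendsto (fun n => (h n ^ p)⁻¹ * ∫ e, K ((h n)⁻¹ • (x - e.1)) ^ 2 ∂(pairLaw g Q))
      atTop (𝓝 (g x * ∫ u, K u ^ 2)) := by
    have h1 := (R.tendsto_of_sqrt_mul (R.tendsto_moment_univ hk hk0 hkM hki hks)).add_const
      (g x * ∫ u, K u ^ 2)
    rw [zero_add] at h1
    exact h1.congr fun n => sub_add_cancel _ _
  have hI := R.eventually_mem_Icc hβ hκ hl
  have hI' := R.eventually_mem_Icc hβ' hκ' hl'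
  have hmin : Tendsto (fun n => min (β n) (β' n) / α n) atTop (𝓝 (min b b')) := by
    refine (hβ.min hβ').congr fun n => ?_
    rw [min_div_div_right (R.α_pos n).le]
  have m1 := moment hmin (R.eventually_mem_Icc hmin (lt_min hκ hκ') ((min_le_left _ _).trans_lt hl))
  have m2 := moment hβ hI
  have m3 := moment hβ' hI'
  -- In the expanded product each centring constant brings a factor `α n → 0`, so only the joint
  -- exceedance term survives.
  have t := ((m1.sub ((R.α_tendsto.const_mul τ').mul m2)).sub
    ((R.α_tendsto.const_mul τ).mul m3)).add ((R.α_tendsto.const_mul (τ * τ')).mul m0)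
  simp only [mul_zero, zero_mul, sub_zero, add_zero] at t
  refine t.congr' ?_
  filter_upwards [R.eventually_sqrt_pos, R.eventually_max_condQuantile hI hI'] with n hn hmax
  have hsq := R.sq_sqrt n
  set r := √((n : ℝ) * h n ^ p * α n) with hr
  have hh : h n ^ p ≠ 0 := (pow_pos (R.h_pos n) p).ne'
  have hα := (R.α_pos n).ne'
  have i1 := fun y => integrable_kernel_indicator (μ := pairLaw g Q) hk hk0 hkM x (h n) y
  have i0 := integrable_kernel (μ := pairLaw g Q) hk hk0 hkM x (h n)
  have hint : ∫ e, kernelTerm Q K x (h n) r (β n) (τ * α n) e *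
      kernelTerm Q K x (h n) r (β' n) (τ' * α n) e ∂(pairLaw g Q) =
      (∫ e, K ((h n)⁻¹ • (x - e.1)) ^ 2 * (Ioi (condQuantile Q
        (min (β n) (β' n)) x)).indicator 1 e.2 ∂(pairLaw g Q) -
      (τ' * α n) * ∫ e, K ((h n)⁻¹ • (x - e.1)) ^ 2 *
        (Ioi (condQuantile Q (β n) x)).indicator 1 e.2 ∂(pairLaw g Q) -
      (τ * α n) * ∫ e, K ((h n)⁻¹ • (x - e.1)) ^ 2 *
        (Ioi (condQuantile Q (β' n) x)).indicator 1 e.2 ∂(pairLaw g Q) +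
      (τ * α n) * (τ' * α n) * ∫ e, K ((h n)⁻¹ • (x - e.1)) ^ 2 ∂(pairLaw g Q)) / r ^ 2 := by
    rw [← integral_sub_sub_add (i1 _) (i1 _) (i1 _) i0, ← integral_div]
    refine integral_congr_ae (ae_of_all _ fun e => ?_)
    simp only [kernelTerm]
    have hprod : (Ioi (condQuantile Q (min (β n) (β' n)) x)).indicator (1 : ℝ → ℝ) e.2 =
        (Ioi (condQuantile Q (β n) x)).indicator (1 : ℝ → ℝ) e.2 *
          (Ioi (condQuantile Q (β' n) x)).indicator (1 : ℝ → ℝ) e.2 := by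
      rw [← hmax, ← Ioi_inter_Ioi, inter_indicator_one]
      rfl
    rw [hprod]
    ring
  rw [hint]
  generalize ∫ e, K ((h n)⁻¹ • (x - e.1)) ^ 2 * (Ioi (condQuantile Q
        (min (β n) (β' n)) x)).indicator 1 e.2 ∂(pairLaw g Q) = I1
  generalize ∫ e, K ((h n)⁻¹ • (x - e.1)) ^ 2 *
        (Ioi (condQuantile Q (β n) x)).indicator 1 e.2 ∂(pairLaw g Q) = I2
  generalize ∫ e, K ((h n)⁻¹ • (x - e.1)) ^ 2 *
        (Ioi (condQuantile Q (β' n) x)).indicator 1 e.2 ∂(pairLaw g Q) = I3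
  generalize ∫ e, K ((h n)⁻¹ • (x - e.1)) ^ 2 ∂(pairLaw g Q) = I0
  have hnr : (n : ℝ) = r ^ 2 / (h n ^ p * α n) := by rw [hsq]; field_simp
  rw [hnr]
  field_simp

end ExtremalRegime

section Sample

variable {p : ℕ} {Ω : Type*} [MeasurableSpace Ω] {P : Measure Ω} {X : ℕ → Ω → Cov p}
  {Y : ℕ → Ω → ℝ} {g : Cov p → ℝ} {Q : Kernel (Cov p) ℝ}

lemma IsSample.measurable_pair (hs : IsSample P X Y g Q) (i : ℕ) :
    Measurable fun ω => (X i ω, Y i ω) := (hs.measurable_X i).prodMk (hs.measurable_Y i)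

lemma IsSample.isProbabilityMeasure_pairLaw [IsProbabilityMeasure P] (hs : IsSample P X Y g Q) :
    IsProbabilityMeasure (pairLaw g Q) := by
  rw [pairLaw, ← hs.law 0]
  exact Measure.isProbabilityMeasure_map (hs.measurable_pair 0).aemeasurable

end Sample

/-- The term of the centred kernel sum of level `τ α` at the quantile whose level is shifted by `z`
standard units. -/
noncomputable def shiftedTerm {p : ℕ} (Q : Kernel (Cov p) ℝ) (K : Cov p → ℝ) (γ : ℝ) (x : Cov p)
    (h α : ℕ → ℝ) (τ z : ℝ) (n : ℕ) : Cov p × ℝ → ℝ :=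
  kernelTerm Q K x (h n) (√((n : ℝ) * h n ^ p * α n))
    (τ * α n * (1 - τ ^ γ * z / √((n : ℝ) * h n ^ p * α n))) (τ * α n)

namespace ExtremalRegime

variable {p : ℕ} {Q : Kernel (Cov p) ℝ} {g K : Cov p → ℝ} {γ L κ l : ℝ}
  {x : Cov p} {h α : ℕ → ℝ}

lemma measurable_shiftedTerm (R : ExtremalRegime Q g K γ L κ l x h α) (τ z : ℝ) (n : ℕ) :
    Measurable (shiftedTerm Q K γ x h α τ z n) :=
  measurable_kernelTerm Q R.kernel.measurable _ _ _ _ _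

/-- The bound is `sup K / r`, uniform in the level and the shift; it supplies the vanishing entries
required by the central limit theorem. -/
lemma exists_abs_shiftedTerm_le (R : ExtremalRegime Q g K γ L κ l x h α) :
    ∃ C : ℕ → ℝ, Tendsto C atTop (𝓝 0) ∧ ∀ τ : ℝ, 0 < τ → τ ≤ 1 → ∀ z n e,
      |shiftedTerm Q K γ x h α τ z n e| ≤ C n := by
  obtain ⟨M, hM⟩ := R.kernel.bounded
  refine ⟨fun n => M / √((n : ℝ) * h n ^ p * α n), ?_, fun τ hτ hτ1 z n e => ?_⟩
  · exact tendsto_const_nhds.div_atTop R.sqrt_tendsto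
  · refine abs_kernelTerm_le Q R.kernel.nonneg hM x _ _ (Real.sqrt_nonneg _) ⟨?_, ?_⟩ e
    · exact (mul_pos hτ (R.α_pos n)).le
    · exact mul_le_one₀ hτ1 (R.α_pos n).le (R.α_lt_one n).le

variable [IsFiniteMeasure (pairLaw g Q)]

lemma integrable_shiftedTerm (R : ExtremalRegime Q g K γ L κ l x h α) {τ : ℝ} (hτ : 0 < τ)
    (hτ1 : τ ≤ 1) (z : ℝ) (n : ℕ) :
    Integrable (shiftedTerm Q K γ x h α τ z n) (pairLaw g Q) := by
  obtain ⟨C, -, hC⟩ := R.exists_abs_shiftedTerm_le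
  exact Integrable.of_bound (R.measurable_shiftedTerm τ z n).aestronglyMeasurable (C n)
    (ae_of_all _ (hC τ hτ hτ1 z n))

lemma integrable_shiftedTerm_mul (R : ExtremalRegime Q g K γ L κ l x h α) {τ τ' : ℝ} (hτ : 0 < τ)
    (hτ1 : τ ≤ 1) (hτ' : 0 < τ') (hτ1' : τ' ≤ 1) (z z' : ℝ) (n : ℕ) :
    Integrable (fun e => shiftedTerm Q K γ x h α τ z n e * shiftedTerm Q K γ x h α τ' z' n e)
      (pairLaw g Q) := by
  obtain ⟨C, -, hC⟩ := R.exists_abs_shiftedTerm_le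
  exact (R.integrable_shiftedTerm hτ' hτ1' z' n).bdd_mul
    (R.measurable_shiftedTerm τ z n).aestronglyMeasurable (ae_of_all _ (hC τ hτ hτ1 z n))

variable [IsMarkovKernel Q]

lemma tendsto_shiftedTerm_mul (R : ExtremalRegime Q g K γ L κ l x h α) {τ τ' : ℝ}
    (hκ : κ < τ) (hl : τ < l) (hκ' : κ < τ') (hl' : τ' < l) (z z' : ℝ) :
    Tendsto (fun n : ℕ => n * ∫ e, shiftedTerm Q K γ x h α τ z n e *
      shiftedTerm Q K γ x h α τ' z' n e ∂(pairLaw g Q)) atTop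
      (𝓝 (g x * min τ τ' * ∫ u, K u ^ 2)) :=
  R.tendsto_second_moment (R.level_div_tendsto τ z) hκ hl (R.level_div_tendsto τ' z') hκ' hl' τ τ'

lemma tendsto_mean_shiftedTerm (R : ExtremalRegime Q g K γ L κ l x h α) {τ : ℝ} (hτ : 0 < τ)
    (hκ : κ < τ) (hl : τ < l) :
    Tendsto (fun n : ℕ => n * ∫ e, shiftedTerm Q K γ x h α τ 0 n e ∂(pairLaw g Q)) atTop
      (𝓝 0) := by
  have h1 := R.tendsto_mean hτ hκ hl 0
  rwa [show -(g x * τ ^ (γ + 1) * 0) = 0 by simp] at h1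

/-- Mean of the increments of the kernel sums. -/
lemma tendsto_mean_increment (R : ExtremalRegime Q g K γ L κ l x h α) {τ : ℝ} (hτ : 0 < τ)
    (hτ1 : τ ≤ 1) (hκ : κ < τ) (hl : τ < l) (z : ℝ) :
    Tendsto (fun n : ℕ => n * ∫ e, (shiftedTerm Q K γ x h α τ z n e -
      shiftedTerm Q K γ x h α τ 0 n e) ∂(pairLaw g Q)) atTop (𝓝 (-(g x * τ ^ (γ + 1) * z))) := by
  have h1 := (R.tendsto_mean hτ hκ hl z).sub (R.tendsto_mean_shiftedTerm hτ hκ hl)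
  rw [sub_zero] at h1
  refine h1.congr fun n => ?_
  rw [integral_sub (R.integrable_shiftedTerm hτ hτ1 z n) (R.integrable_shiftedTerm hτ hτ1 0 n)]
  exact (mul_sub _ _ _).symm

/-- The increments of the kernel sums have vanishing second moments. -/
lemma tendsto_second_moment_increment (R : ExtremalRegime Q g K γ L κ l x h α) {τ : ℝ}
    (hτ : 0 < τ) (hτ1 : τ ≤ 1) (hκ : κ < τ) (hl : τ < l) (z : ℝ) :
    Tendsto (fun n : ℕ => n * ∫ e, (shiftedTerm Q K γ x h α τ z n e -
      shiftedTerm Q K γ x h α τ 0 n e) ^ 2 ∂(pairLaw g Q)) atTop (𝓝 0) := by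
  have m := fun a b => R.tendsto_shiftedTerm_mul hκ hl hκ hl a b
  have i := fun a b n => R.integrable_shiftedTerm_mul hτ hτ1 hτ hτ1 a b n
  -- Shifting by `z` or `0` leaves the limiting ratio of levels equal to `τ`, so all the second
  -- moments in the expanded square share one limit and cancel.
  have h1 := (((m z z).sub ((m z 0).const_mul 1)).sub ((m z 0).const_mul 1)).add
    ((m 0 0).const_mul 1)
  simp only [one_mul, sub_self, zero_sub, neg_add_cancel] at h1
  refine h1.congr fun n => ?_
  have e := integral_sub_sub_add (i z z n) (i z 0 n) (i z 0 n) (i 0 0 n) 1 1 1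
  have e2 : ∫ e, (shiftedTerm Q K γ x h α τ z n e - shiftedTerm Q K γ x h α τ 0 n e) ^ 2
      ∂(pairLaw g Q) = ∫ e, (shiftedTerm Q K γ x h α τ z n e * shiftedTerm Q K γ x h α τ z n e -
      1 * (shiftedTerm Q K γ x h α τ z n e * shiftedTerm Q K γ x h α τ 0 n e) -
      1 * (shiftedTerm Q K γ x h α τ z n e * shiftedTerm Q K γ x h α τ 0 n e) +
      1 * (shiftedTerm Q K γ x h α τ 0 n e * shiftedTerm Q K γ x h α τ 0 n e)) ∂(pairLaw g Q) := by
    refine integral_congr_ae (ae_of_all _ fun e => ?_)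
    ring
  rw [e2, e]
  ring

variable {J : ℕ} {τ : Fin J → ℝ}

lemma tendsto_mean_linearComb (R : ExtremalRegime Q g K γ L κ l x h α) (hτ : ∀ j, 0 < τ j)
    (hτ1 : ∀ j, τ j ≤ 1) (hκ : ∀ j, κ < τ j) (hl : ∀ j, τ j < l) (a : Fin J → ℝ) :
    Tendsto (fun n : ℕ => n * ∫ e, ∑ j, a j * shiftedTerm Q K γ x h α (τ j) 0 n e
      ∂(pairLaw g Q)) atTop (𝓝 0) := by
  have h1 := tendsto_finsetSum (Finset.univ : Finset (Fin J)) fun j _ =>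
    (R.tendsto_mean_shiftedTerm (hτ j) (hκ j) (hl j)).const_mul (a j)
  simp only [mul_zero, Finset.sum_const_zero] at h1
  refine h1.congr fun n => ?_
  rw [integral_finsetSum _ fun j _ =>
    (R.integrable_shiftedTerm (hτ j) (hτ1 j) 0 n).const_mul (a j), Finset.mul_sum]
  refine Finset.sum_congr rfl fun j _ => ?_
  rw [integral_const_mul, mul_left_comm]

lemma tendsto_second_moment_linearComb (R : ExtremalRegime Q g K γ L κ l x h α)
    (hτ : ∀ j, 0 < τ j) (hτ1 : ∀ j, τ j ≤ 1) (hκ : ∀ j, κ < τ j) (hl : ∀ j, τ j < l)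
    (a : Fin J → ℝ) :
    Tendsto (fun n : ℕ => n * ∫ e, (∑ j, a j * shiftedTerm Q K γ x h α (τ j) 0 n e) ^ 2
      ∂(pairLaw g Q)) atTop
      (𝓝 (∑ i, ∑ j, a i * a j * (g x * min (τ i) (τ j) * ∫ u, K u ^ 2))) := by
  have h1 := tendsto_finsetSum (Finset.univ : Finset (Fin J)) fun i _ =>
    tendsto_finsetSum (Finset.univ : Finset (Fin J)) fun j _ =>
      (R.tendsto_shiftedTerm_mul (hκ i) (hl i) (hκ j) (hl j) 0 0).const_mul (a i * a j)
  refine h1.congr fun n => ?_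
  have hi := fun i j => (R.integrable_shiftedTerm_mul (hτ i) (hτ1 i) (hτ j) (hτ1 j) 0 0 n).const_mul
    (a i * a j)
  have e : ∫ e, (∑ j, a j * shiftedTerm Q K γ x h α (τ j) 0 n e) ^ 2 ∂(pairLaw g Q) =
      ∫ e, ∑ i, ∑ j, a i * a j * (shiftedTerm Q K γ x h α (τ i) 0 n e *
        shiftedTerm Q K γ x h α (τ j) 0 n e) ∂(pairLaw g Q) := by
    refine integral_congr_ae (ae_of_all _ fun e => ?_)
    simp only
    rw [pow_two, Finset.sum_mul_sum]
    refine Finset.sum_congr rfl fun i _ => Finset.sum_congr rfl fun j _ => ?_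
    ring
  rw [e, integral_finsetSum _ fun i _ => integrable_finsetSum _ fun j _ => hi i j, Finset.mul_sum]
  refine Finset.sum_congr rfl fun i _ => ?_
  rw [integral_finsetSum _ fun j _ => hi i j, Finset.mul_sum]
  refine Finset.sum_congr rfl fun j _ => ?_
  rw [integral_const_mul]
  ring

end ExtremalRegime

/-- The quadratic form of the asymptotic covariance matrix in terms of the limiting second moments
of the kernel sums. -/
lemma dotProduct_asymptoticCov {p J : ℕ} {K g : Cov p → ℝ} {γ : Cov p → ℝ} {τ : Fin J → ℝ}
    {x : Cov p} (hg : 0 < g x) (hτ_anti : StrictAnti τ) (hτ : ∀ j, 0 < τ j) (t : Fin J → ℝ) :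
    t ⬝ᵥ (asymptoticCov K g γ τ x).mulVec t = ∑ i, ∑ j, t i / (g x * τ i ^ (γ x + 1)) *
      (t j / (g x * τ j ^ (γ x + 1))) * (g x * min (τ i) (τ j) * ∫ u, K u ^ 2) := by
  simp only [dotProduct, Matrix.mulVec, Finset.mul_sum]
  refine Finset.sum_congr rfl fun i _ => Finset.sum_congr rfl fun j _ => ?_
  simp only [asymptoticCov, sigmaMatrix, Matrix.smul_apply, Matrix.of_apply, smul_eq_mul]
  have hi := hτ i
  have hj := hτ j
  -- As `τ` decreases, `τ (min i j)` is the larger of the two levels; this identifies `min (τ i) (τ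
  -- j) / (τ i τ j)` with `(τ (min i j))⁻¹`.
  have hmm : min (τ i) (τ j) * τ (min i j) = τ i * τ j := by
    rw [hτ_anti.antitone.map_min, min_mul_max]
  have hm : min (τ i) (τ j) = τ i * τ j * (τ (min i j))⁻¹ := by
    rw [← hmm, mul_inv_cancel_right₀ (hτ _).ne']
  have hpi : 0 < τ i ^ γ x := Real.rpow_pos_of_pos hi _
  have hpj : 0 < τ j ^ γ x := Real.rpow_pos_of_pos hj _
  rw [hm, Real.rpow_neg (mul_pos hi hj).le, Real.mul_rpow hi.le hj.le, Real.rpow_add hi,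
    Real.rpow_add hj, Real.rpow_one, Real.rpow_one]
  field_simp

lemma asymptoticCov_isHermitian {p J : ℕ} (K g : Cov p → ℝ) (γ : Cov p → ℝ) (τ : Fin J → ℝ)
    (x : Cov p) : (asymptoticCov K g γ τ x).IsHermitian := by
  ext i j
  simp [asymptoticCov, sigmaMatrix, mul_comm (τ i), min_comm i j]

/-- A random vector in `ℝ^J` is small in probability if its coordinates are. -/
lemma tendsto_measureReal_norm_of_coord {Ω : Type*} [MeasurableSpace Ω] {P : Measure Ω}
    [IsProbabilityMeasure P] {J : ℕ} {U : ℕ → Ω → EuclideanSpace ℝ (Fin J)}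
    (hU : ∀ j, ∀ ε, 0 < ε → Tendsto (fun n => P.real {ω | ε ≤ |U n ω j|}) atTop (𝓝 0))
    {ε : ℝ} (hε : 0 < ε) : Tendsto (fun n => P.real {ω | ε ≤ ‖U n ω‖}) atTop (𝓝 0) := by
  set d : ℝ := ε / (J + 1) with hd
  have hd0 : 0 < d := by positivity
  have hsum : Tendsto (fun n => ∑ j, P.real {ω | d ≤ |U n ω j|}) atTop (𝓝 0) := by
    simpa using tendsto_finsetSum (Finset.univ : Finset (Fin J)) fun j _ => hU j d hd0
  refine squeeze_zero (fun n => measureReal_nonneg) (fun n => ?_) hsum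
  have hsub : {ω | ε ≤ ‖U n ω‖} ⊆ ⋃ j ∈ (Finset.univ : Finset (Fin J)), {ω | d ≤ |U n ω j|} := by
    intro ω hω
    by_contra hcon
    simp only [mem_iUnion, mem_ofPred_eq, not_exists, not_le] at hcon
    have h1 : ‖U n ω‖ ^ 2 ≤ J * d ^ 2 := by
      rw [EuclideanSpace.norm_sq_eq]
      refine (Finset.sum_le_card_nsmul _ _ (d ^ 2) fun j _ => ?_).trans (by simp)
      exact pow_le_pow_left₀ (norm_nonneg _) (hcon j (Finset.mem_univ j)).le 2
    have h2 : ε = d * (J + 1) := by rw [hd]; field_simp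
    have h3 : ε ^ 2 ≤ ‖U n ω‖ ^ 2 := pow_le_pow_left₀ hε.le hω 2
    rw [h2] at h3
    have hJ : (0 : ℝ) ≤ J := Nat.cast_nonneg J
    have : 0 < d ^ 2 := by positivity
    nlinarith
  exact (measureReal_mono hsub (measure_ne_top _ _)).trans (measureReal_biUnion_finset_le _ _)

/-! ### Bahadur representation and joint asymptotic normality. -/

section Main

variable {p J : ℕ} {Ω : Type*} {X : ℕ → Ω → Cov p} {Y : ℕ → Ω → ℝ} {Q : Kernel (Cov p) ℝ}
  {g K : Cov p → ℝ} {γ L κ l : ℝ} {x : Cov p} {h α : ℕ → ℝ}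

/-- The centred and normalized kernel sum of level `τ α` at the quantile whose level is shifted by
`z` standard units. -/
noncomputable def shiftedSum (Q : Kernel (Cov p) ℝ) (K : Cov p → ℝ) (γ : ℝ) (x : Cov p)
    (h α : ℕ → ℝ) (X : ℕ → Ω → Cov p) (Y : ℕ → Ω → ℝ) (τ z : ℝ) (n : ℕ) (ω : Ω) : ℝ :=
  ∑ i ∈ Finset.range n, shiftedTerm Q K γ x h α τ z n (X i ω, Y i ω)

lemma ExtremalRegime.kernelQuantile_le_iff (R : ExtremalRegime Q g K γ L κ l x h α) {τ : ℝ}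
    (hτ : 0 < τ) (hτ1 : τ ≤ 1) (z : ℝ) {n : ℕ} (hn : 0 < √((n : ℝ) * h n ^ p * α n)) {ω : Ω}
    (hω : ∑ i ∈ Finset.range n, K ((h n)⁻¹ • (x - X i ω)) ≠ 0) :
    kernelQuantile K (h n) n (fun i => X i ω) (fun i => Y i ω) (τ * α n) x ≤
        condQuantile Q (τ * α n * (1 - τ ^ γ * z / √((n : ℝ) * h n ^ p * α n))) x ↔
      shiftedSum Q K γ x h α X Y τ z n ω ≤ 0 := by
  rw [ExtremalQuantile.kernelQuantile_le_iff R.kernel.nonneg (R.h_pos n) hω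
    (mul_pos hτ (R.α_pos n)) (mul_lt_one_of_nonneg_of_lt_one_right hτ1 (R.α_pos n).le
      (R.α_lt_one n))]
  simp only [shiftedSum, shiftedTerm, kernelTerm]
  rw [← Finset.sum_div, div_le_iff₀ hn, zero_mul]

/-- The quadratic form is a limit of nonnegative second moments of linear combinations of the kernel
terms. -/
lemma ExtremalRegime.asymptoticCov_posSemidef {γ : Cov p → ℝ}
    (R : ExtremalRegime Q g K (γ x) L κ l x h α) [IsMarkovKernel Q]
    [IsFiniteMeasure (pairLaw g Q)] {τ : Fin J → ℝ}
    (hτ_anti : StrictAnti τ) (hτ : ∀ j, 0 < τ j) (hτ1 : ∀ j, τ j ≤ 1) (hκ : ∀ j, κ < τ j)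
    (hl : ∀ j, τ j < l) : (asymptoticCov K g γ τ x).PosSemidef := by
  refine Matrix.PosSemidef.of_dotProduct_mulVec_nonneg (asymptoticCov_isHermitian K g γ τ x)
    fun t => ?_
  rw [star_trivial, dotProduct_asymptoticCov R.g_pos hτ_anti hτ]
  exact ge_of_tendsto' (R.tendsto_second_moment_linearComb hτ hτ1 hκ hl _) fun n =>
    mul_nonneg (Nat.cast_nonneg n) (integral_nonneg fun e => sq_nonneg _)

variable [MeasurableSpace Ω] {P : Measure Ω}

lemma ExtremalRegime.measurable_shiftedSum (R : ExtremalRegime Q g K γ L κ l x h α)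
    (hs : IsSample P X Y g Q) (τ z : ℝ) (n : ℕ) :
    Measurable (shiftedSum Q K γ x h α X Y τ z n) :=
  Finset.measurable_fun_sum _ fun i _ =>
    (R.measurable_shiftedTerm τ z n).comp (hs.measurable_pair i)

variable [IsProbabilityMeasure P] [IsMarkovKernel Q]

lemma ExtremalRegime.tendsto_measureReal_shiftedSum_increment
    (R : ExtremalRegime Q g K γ L κ l x h α) (hs : IsSample P X Y g Q) {τ : ℝ} (hτ : 0 < τ)
    (hτ1 : τ ≤ 1) (hκ : κ < τ) (hl : τ < l) (z : ℝ) {ε : ℝ} (hε : 0 < ε) :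
    Tendsto (fun n => P.real {ω | ε ≤ |shiftedSum Q K γ x h α X Y τ z n ω -
      shiftedSum Q K γ x h α X Y τ 0 n ω + g x * τ ^ (γ + 1) * z|}) atTop (𝓝 0) := by
  have := hs.isProbabilityMeasure_pairLaw
  obtain ⟨C, -, hC⟩ := R.exists_abs_shiftedTerm_le
  have h1 := tendsto_measureReal_triangularArray (P := P) (ν := pairLaw g Q) hs.measurable_pair
    hs.indep hs.law (φ := fun n e => shiftedTerm Q K γ x h α τ z n e -
      shiftedTerm Q K γ x h α τ 0 n e)
    (fun n => (R.measurable_shiftedTerm τ z n).sub (R.measurable_shiftedTerm τ 0 n))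
    (C := fun n => C n + C n)
    (Eventually.of_forall fun n e => (abs_sub _ _).trans
      (add_le_add (hC τ hτ hτ1 z n e) (hC τ hτ hτ1 0 n e)))
    (R.tendsto_mean_increment hτ hτ1 hκ hl z) (R.tendsto_second_moment_increment hτ hτ1 hκ hl z) hε
  simpa only [Finset.sum_sub_distrib, sub_neg_eq_add, shiftedSum] using h1

/-- The event that no covariate receives positive weight is asymptotically negligible. -/
lemma ExtremalRegime.tendsto_measureReal_weights_eq_zero
    (R : ExtremalRegime Q g K γ L κ l x h α) (hs : IsSample P X Y g Q) {τ : ℝ} (hτ : 0 < τ)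
    (hτ1 : τ ≤ 1) (hκ : κ < τ) (hl : τ < l) :
    Tendsto (fun n => P.real {ω | ∑ i ∈ Finset.range n, K ((h n)⁻¹ • (x - X i ω)) = 0}) atTop
      (𝓝 0) := by
  have hc : 0 < g x * τ ^ (γ + 1) := mul_pos R.g_pos (Real.rpow_pos_of_pos hτ _)
  -- If all weights vanish, both sums are zero and the increment at `z = 1` misses its limit `-c` by
  -- exactly `c`; the event lies in one already known to be negligible.
  refine squeeze_zero (fun n => measureReal_nonneg) (fun n => ?_)
    (R.tendsto_measureReal_shiftedSum_increment hs hτ hτ1 hκ hl 1 hc)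
  refine measureReal_mono fun ω hω => ?_
  have h0 : ∀ i ∈ Finset.range n, K ((h n)⁻¹ • (x - X i ω)) = 0 :=
    (Finset.sum_eq_zero_iff_of_nonneg fun i _ => R.kernel.nonneg _).1 hω
  have hz : ∀ z, shiftedSum Q K γ x h α X Y τ z n ω = 0 := fun z =>
    Finset.sum_eq_zero fun i hi => by simp [shiftedTerm, kernelTerm, h0 i hi]
  show g x * τ ^ (γ + 1) ≤ |_|
  rw [hz, hz, sub_zero, zero_add, mul_one]
  exact le_abs_self _

/-- Bahadur-type representation of a coordinate of the normalized error. -/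
lemma ExtremalRegime.tendsto_measureReal_normalizedError
    (R : ExtremalRegime Q g K γ L κ l x h α) (hs : IsSample P X Y g Q) {τ : Fin J → ℝ}
    (hτ : ∀ j, 0 < τ j) (hτ1 : ∀ j, τ j ≤ 1) (hκ : ∀ j, κ < τ j) (hl : ∀ j, τ j < l) (j : Fin J)
    {ε : ℝ} (hε : 0 < ε) :
    Tendsto (fun n => P.real {ω | ε ≤ |normalizedError Q K τ x n (h n) (α n) (fun i => X i ω)
      (fun i => Y i ω) j - shiftedSum Q K γ x h α X Y (τ j) 0 n ω /
        (g x * τ j ^ (γ + 1))|}) atTop (𝓝 0) := by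
  have := hs.isProbabilityMeasure_pairLaw
  obtain ⟨C, -, hC⟩ := R.exists_abs_shiftedTerm_le
  have hc : 0 < g x * τ j ^ (γ + 1) := mul_pos R.g_pos (Real.rpow_pos_of_pos (hτ j) _)
  have hS := condSurvival_antitone Q x
  have he := bot_lt_rightEndpoint_condSurvival Q x
  have hexp := fun z => R.vonMises.tendsto_upperQuantile_sub hS he (z := z) (hτ j) R.α_pos
    R.α_tendsto R.eventually_sqrt_pos R.sqrt_tendsto.inv_tendsto_atTop
  obtain ⟨a, ha, hreg⟩ := R.vonMises.exists_regular hS he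
  have hα' : Tendsto α atTop (𝓝[>] 0) :=
    tendsto_nhdsWithin_iff.2 ⟨R.α_tendsto, Eventually.of_forall R.α_pos⟩
  have hf : ∀ᶠ n in atTop, 0 < condDensity Q x (condQuantile Q (α n) x) := by
    have : ∀ᶠ y in leftOfEndpoint (condSurvival Q x), 0 < condDensity Q x y :=
      (eventually_leftOfEndpoint he).2 ⟨a, ha, fun y h1 h2 => neg_pos.2 (hreg y h1 h2).2.2⟩
    exact ((R.vonMises.tendsto_upperQuantile hS he).comp hα').eventually this
  have hscale : ∀ n : ℕ, √((n : ℝ) * h n ^ p * (α n)⁻¹) =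
      √((n : ℝ) * h n ^ p * α n) / α n := fun n => by
    have hα := R.α_pos n
    have e : (n : ℝ) * h n ^ p * (α n)⁻¹ = ((n : ℝ) * h n ^ p * α n) / α n ^ 2 := by
      field_simp
    rw [e, Real.sqrt_div' _ (sq_nonneg _), Real.sqrt_sq hα.le]
  have hW : ∀ n ω, normalizedError Q K τ x n (h n) (α n) (fun i => X i ω) (fun i => Y i ω) j =
      condDensity Q x (condQuantile Q (α n) x) * (√((n : ℝ) * h n ^ p * α n) / α n) *
      (kernelQuantile K (h n) n (fun i => X i ω) (fun i => Y i ω) (τ j * α n) x -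
        condQuantile Q (τ j * α n) x) := fun n ω => by
    simp only [normalizedError, hscale]
  -- The expansion `hexp` puts the normalized shifted quantile within `δ` of `z`, which is the slack
  -- allowed in both comparisons.
  refine tendsto_measureReal_inversion (P := P) (Z := shiftedSum Q K γ x h α X Y (τ j))
    (bad := fun n => {ω | ∑ i ∈ Finset.range n, K ((h n)⁻¹ • (x - X i ω)) = 0}) hc
    (R.tendsto_measureReal_weights_eq_zero hs (hτ j) (hτ1 j) (hκ j) (hl j))
    (fun z ε hε => R.tendsto_measureReal_shiftedSum_increment hs (hτ j) (hτ1 j) (hκ j) (hl j) z hε)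
    ?_ ?_ ?_ hε
  · intro η hη
    have h1 := R.tendsto_mean_shiftedTerm (hτ j) (hκ j) (hl j)
    have h2 := R.tendsto_shiftedTerm_mul (hκ j) (hl j) (hκ j) (hl j) 0 0
    simp only [← pow_two] at h2
    exact tight_triangularArray hs.measurable_pair hs.indep hs.law
      (fun n => R.measurable_shiftedTerm (τ j) 0 n)
      (Eventually.of_forall fun n e => hC (τ j) (hτ j) (hτ1 j) 0 n e) h1 h2 hη
  · intro z δ hδ
    filter_upwards [hf, R.eventually_sqrt_pos,
      (hexp z).eventually (gt_mem_nhds (lt_add_of_pos_right z hδ))] with n hfn hn hz ω hω hZ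
    have hq := (R.kernelQuantile_le_iff (Y := Y) (hτ j) (hτ1 j) z hn hω).2 hZ
    rw [hW]
    refine le_trans (mul_le_mul_of_nonneg_left (sub_le_sub_right hq _) ?_) hz.le
    exact mul_nonneg hfn.le (div_nonneg hn.le (R.α_pos n).le)
  · intro z δ hδ
    filter_upwards [hf, R.eventually_sqrt_pos,
      (hexp z).eventually (lt_mem_nhds (sub_lt_self z hδ))] with n hfn hn hz ω hω hZ
    have hq := not_le.1 fun hle => absurd
      ((R.kernelQuantile_le_iff (Y := Y) (hτ j) (hτ1 j) z hn hω).1 hle) (not_le.2 hZ)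
    rw [hW]
    refine hz.le.trans (mul_le_mul_of_nonneg_left (sub_le_sub_right hq.le _) ?_)
    exact mul_nonneg hfn.le (div_nonneg hn.le (R.α_pos n).le)

/-- Joint asymptotic normality of the kernel sums at the conditional quantiles. -/
lemma ExtremalRegime.tendstoInDistribution_shiftedSum {γ : Cov p → ℝ}
    (R : ExtremalRegime Q g K (γ x) L κ l x h α) (hs : IsSample P X Y g Q) {τ : Fin J → ℝ}
    (hτ_anti : StrictAnti τ) (hτ : ∀ j, 0 < τ j) (hτ1 : ∀ j, τ j ≤ 1) (hκ : ∀ j, κ < τ j)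
    (hl : ∀ j, τ j < l) (hpos : (asymptoticCov K g γ τ x).PosSemidef) :
    TendstoInDistribution (fun (n : ℕ) (ω : Ω) => (WithLp.toLp 2 fun j =>
        shiftedSum Q K (γ x) x h α X Y (τ j) 0 n ω / (g x * τ j ^ (γ x + 1)) :
        EuclideanSpace ℝ (Fin J)))
      atTop id (fun _ => P) (multivariateGaussian 0 (asymptoticCov K g γ τ x)) := by
  have := hs.isProbabilityMeasure_pairLaw
  obtain ⟨C, hC0, hC⟩ := R.exists_abs_shiftedTerm_le
  have hmeas : ∀ n, Measurable (fun ω => (WithLp.toLp 2 fun j =>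
        shiftedSum Q K (γ x) x h α X Y (τ j) 0 n ω / (g x * τ j ^ (γ x + 1)) :
        EuclideanSpace ℝ (Fin J))) := fun n =>
    (WithLp.measurable_toLp 2 _).comp (measurable_pi_lambda _ fun j =>
      (R.measurable_shiftedSum hs (τ j) 0 n).div_const _)
  refine ⟨fun n => (hmeas n).aemeasurable, aemeasurable_id, ?_⟩
  refine ProbabilityMeasure.tendsto_iff_tendsto_charFun.2 fun t => ?_
  simp only [ProbabilityMeasure.coe_mk, Measure.map_id]
  rw [charFun_multivariateGaussian hpos, dotProduct_asymptoticCov R.g_pos hτ_anti hτ]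
  -- Cramér–Wold: the characteristic function of the vector at `t` is that of the scalar sum with
  -- coefficients `a` at `1`.
  set a : Fin J → ℝ := fun j => t j / (g x * τ j ^ (γ x + 1)) with ha
  have hclt := tendsto_charFun_triangularArray (P := P) (ν := pairLaw g Q) hs.measurable_pair
    hs.indep hs.law
    (φ := fun n e => ∑ j, a j * shiftedTerm Q K (γ x) x h α (τ j) 0 n e)
    (fun n => Finset.measurable_fun_sum _ fun j _ =>
      (R.measurable_shiftedTerm (τ j) 0 n).const_mul (a j))
    (C := fun n => ∑ j, |a j| * C n)
    (Eventually.of_forall fun n e => (Finset.abs_sum_le_sum_abs _ _).trans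
      (Finset.sum_le_sum fun j _ => by
        rw [abs_mul]
        exact mul_le_mul_of_nonneg_left (hC (τ j) (hτ j) (hτ1 j) 0 n e) (abs_nonneg _)))
    (by simpa using tendsto_finsetSum (Finset.univ : Finset (Fin J)) fun j _ =>
      hC0.const_mul |a j|)
    (R.tendsto_mean_linearComb hτ hτ1 hκ hl a) (R.tendsto_second_moment_linearComb hτ hτ1 hκ hl a)
  have hlim : Complex.exp ((inner ℝ t (0 : EuclideanSpace ℝ (Fin J)) : ℝ) * Complex.I -
      ((∑ i, ∑ j, a i * a j * (g x * min (τ i) (τ j) * ∫ u, K u ^ 2) : ℝ) : ℂ) / 2) =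
      Complex.exp (-(((∑ i, ∑ j, a i * a j * (g x * min (τ i) (τ j) * ∫ u, K u ^ 2)) / 2 : ℝ) :
        ℂ)) := by
    rw [inner_zero_right, Complex.ofReal_zero, zero_mul, zero_sub, Complex.ofReal_div,
      Complex.ofReal_ofNat]
  rw [hlim]
  refine hclt.congr fun n => ?_
  have hm : Measurable fun ω => ∑ i ∈ Finset.range n,
      ∑ j, a j * shiftedTerm Q K (γ x) x h α (τ j) 0 n (X i ω, Y i ω) :=
    Finset.measurable_fun_sum _ fun i _ => Finset.measurable_fun_sum _ fun j _ =>
      ((R.measurable_shiftedTerm (τ j) 0 n).comp (hs.measurable_pair i)).const_mul (a j)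
  rw [charFun_apply_real, charFun_apply, integral_map hm.aemeasurable (by fun_prop),
    integral_map (hmeas n).aemeasurable (by fun_prop)]
  refine integral_congr_ae (ae_of_all _ fun ω => ?_)
  simp only [Complex.ofReal_one, one_mul]
  congr 3
  rw [Finset.sum_comm, PiLp.inner_apply]
  refine Finset.sum_congr rfl fun j _ => ?_
  rw [← Finset.mul_sum]
  simp only [ha, shiftedSum, RCLike.inner_apply, conj_trivial]
  ring

end Main

end ExtremalQuantile

theorem theorem1 {p J : ℕ} (hp : 1 ≤ p) (hJ : 1 ≤ J)
    {Ω : Type*} [MeasurableSpace Ω] (P : Measure Ω) [IsProbabilityMeasure P]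
    (X : ℕ → Ω → ExtremalQuantile.Cov p) (Y : ℕ → Ω → ℝ)
    (g : ExtremalQuantile.Cov p → ℝ)
    (Q : Kernel (ExtremalQuantile.Cov p) ℝ) [IsMarkovKernel Q]
    (hsample : ExtremalQuantile.IsSample P X Y g Q)
    (K : ExtremalQuantile.Cov p → ℝ)
    (γ : ExtremalQuantile.Cov p → ℝ) (x : ExtremalQuantile.Cov p)
    (hA1 : ExtremalQuantile.VonMises (ExtremalQuantile.condSurvival Q x) (γ x))
    (hA2 : ∃ c : ℝ, 0 < c ∧ ∀ z z' : ExtremalQuantile.Cov p, |g z - g z'| ≤ c * dist z z')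
    (hA3 : ExtremalQuantile.IsSmoothingKernel K)
    (hgx : 0 < g x)
    (τ : Fin J → ℝ) (hτ_anti : StrictAnti τ) (hτ_pos : ∀ j, 0 < τ j) (hτ_le : ∀ j, τ j ≤ 1)
    (h α : ℕ → ℝ) (hh_pos : ∀ n, 0 < h n) (hh : Tendsto h atTop (𝓝 0))
    (hα_mem : ∀ n, α n ∈ Ioo (0 : ℝ) 1) (hα : Tendsto α atTop (𝓝 0))
    (hgrowth : Tendsto (fun n : ℕ => (n : ℝ) * h n ^ p * α n) atTop atTop)
    (hosc : ∃ κ l : ℝ, 0 < κ ∧ (∀ j, κ < τ j) ∧ (∀ j, τ j < l) ∧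
      Tendsto (fun n : ℕ => (n : ℝ) * h n ^ p * α n *
        (max (h n) (ExtremalQuantile.oscillation Q (h n) κ l x (α n))) ^ 2) atTop (𝓝 0)) :
    (ExtremalQuantile.asymptoticCov K g γ τ x).PosSemidef ∧
    TendstoInDistribution
      (fun (n : ℕ) (ω : Ω) =>
        ExtremalQuantile.normalizedError Q K τ x n (h n) (α n) (fun i => X i ω) (fun i => Y i ω))
      atTop id (fun _ => P)
      (multivariateGaussian 0 (ExtremalQuantile.asymptoticCov K g γ τ x)) := by
  obtain ⟨κ, l, hκ0, hκ, hl, hbias⟩ := hosc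
  obtain ⟨c, hc0, hc⟩ := hA2
  have R : ExtremalQuantile.ExtremalRegime Q g K (γ x) c κ l x h α :=
    { vonMises := hA1
      measurable_g := hsample.measurable_g
      g_nonneg := hsample.g_nonneg
      lipschitz_nonneg := hc0.le
      lipschitz := hc
      g_pos := hgx
      kernel := hA3
      h_pos := hh_pos
      α_pos := fun n => (hα_mem n).1
      α_lt_one := fun n => (hα_mem n).2
      α_tendsto := hα
      growth := hgrowth
      κ_pos := hκ0
      l_pos := (hτ_pos ⟨0, hJ⟩).trans (hl ⟨0, hJ⟩)
      bias := hbias }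
  have := hsample.isProbabilityMeasure_pairLaw
  have hpos := R.asymptoticCov_posSemidef hτ_anti hτ_pos hτ_le hκ hl
  refine ⟨hpos, ?_⟩
  -- Slutsky: the error vector differs from the rescaled kernel sums by a term tending to zero in
  -- probability, checked coordinatewise.
  refine tendstoInDistribution_of_tendstoInMeasure_sub _ _
    (R.tendstoInDistribution_shiftedSum hsample hτ_anti hτ_pos hτ_le hκ hl hpos) ?_ fun n => ?_
  · rw [tendstoInMeasure_iff_measureReal_norm]
    intro ε hε
    simp only [Pi.sub_apply, Pi.zero_apply, sub_zero]
    refine ExtremalQuantile.tendsto_measureReal_norm_of_coord (fun j ε hε => ?_) hε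
    exact R.tendsto_measureReal_normalizedError hsample hτ_pos hτ_le hκ hl j hε
  · refine Measurable.aemeasurable ?_
    refine (WithLp.measurable_toLp 2 _).comp (measurable_pi_lambda _ fun j => ?_)
    refine ((ExtremalQuantile.measurable_kernelQuantile hA3.measurable hA3.nonneg (hh_pos n)
      hsample.measurable_X hsample.measurable_Y (mul_pos (hτ_pos j) (hα_mem n).1) ?_).sub_const
        _).const_mul _
    exact mul_lt_one_of_nonneg_of_lt_one_right (hτ_le j) (hα_mem n).1.le (hα_mem n).2
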